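/- Let $\|\cdot\|_F$ be the Frobenius norm. For a real matrix $A\ne 0$ let $\kappa=\kappa(A)$ be its condition number, i.e. its largest singular value divided by its smallest nonzero singular value. For a real matrix $M\neq 0$ let $|M\rangle=\|M\|_F^{-1}\sum_{i,j}M_{ij}|i\rangle|j\rangle$, where indices are written in binary on the least sufficient number of qubits. Quantum access to $A\in\mathbb R^{l\times m}$ and $B\in\mathbb R^{m\times n}$ means that the following unitaries and their inverses may be used as gates: $|i\rangle|0\rangle\mapsto|i\rangle|A_i\rangle$, where $|A_i\rangle$ is the normalized $i$-th row of $A$ (any unit vector if that row is zero or $i$ is not the label of a row); $|0\rangle|j\rangle\mapsto \|A\|_F^{-1}\sum_i\|A_i\|_2\,|i\rangle|j\rangle$, where $A_i$ is the $i$-th row of $A$; $|0\rangle|0\rangle\mapsto|B\rangle$. Each such use takes time $(1+\log(lmn))^a$ for some fixed $a\in\mathbb N$ (state preparation in polylogarithmic time). Elementary gates (NOT, Hadamard, $T$, CNOT, Toffoli) and one-qubit measurements take time $1$. Theorem. There is a quantum algorithm, determined by $l,m,n,\varepsilon,\delta$ only (it is not given $\kappa$ or any of the norms $\|A\|_F,\|B\|_F,\|AB\|_F$,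 and it uses $A$ and $B$ only through the above access), that performs a sequence of rounds, each one a circuit on qubits initialized in $|0\rangle$ followed by the measurement of a flag qubit, until a round succeeds (the outcome is $1$), such that the following holds. For every $a\in\mathbb N$ there are $C>0$ and $k\in\mathbb N$ such that for all $l,m,n$, all real $A\in\mathbb R^{l\times m}$, $B\in\mathbb R^{m\times n}$ with $AB\ne0$, all $0<\varepsilon\le1$ and $0<\delta<1$, and all access unitaries for $A$ and $B$: (i) whenever a round succeeds, the state after the measurement is, up to a global phase, within Euclidean distance $\varepsilon$ of $|AB\rangle$ (with the flag equal to $1$ and all other qubits in $|0\rangle$); (ii) with probability at least $1-\delta$ the algorithm succeeds within time $$C\,\frac{\|A\|_F\|B\|_F\,\kappa^2}{\varepsilon\,\|AB\|_F}\,\bigl(1+\log(lmn)\bigr)^k\,\bigl(1+\log(1/\delta)\bigr).$$ In other words, the quantum state of $AB$ can be obtained to precision $\varepsilon$ in time $\widetilde O\bigl(\|A\|_F\|B\|_F\,\kappa^2/(\varepsilon\|AB\|_F)\bigr)$. -/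

import Mathlib

open scoped Matrix.Norms.Frobenius

noncomputable section

namespace QMatMul

/-! ### States of finite families of qubits -/

/-- Computational basis labels of the qubits in `W`. -/
abbrev Bits (W : Type) : Type := W → Bool

/-- The all-zero basis label. -/
def zeros (W : Type) : Bits W := fun _ => false

/-- A vector of amplitudes on the qubits in `W`. -/
abbrev State (W : Type) : Type := Bits W → ℂ

/-- The computational basis state `|0…0⟩`. -/
def ketZero (W : Type) [Fintype W] : State W :=
  fun x => if x = zeros W then 1 else 0

/-- The Euclidean (`ℓ²`) norm of an amplitude vector. -/
def stateNorm {W : Type} [Fintype W] [DecidableEq W] (ψ : State W) : ℝ :=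
  ‖(WithLp.toLp 2 ψ : EuclideanSpace ℂ (Bits W))‖

/-- Binary encoding of an index `i < n` by `b` qubits (faithful when `n ≤ 2 ^ b`). -/
def enc {n : ℕ} (b : ℕ) (i : Fin n) : Bits (Fin b) := fun t => (i : ℕ).testBit t

/-- The unnormalized amplitude vector `∑ j, v j |j⟩` on `b` qubits. -/
def ketVec {n : ℕ} (b : ℕ) (v : Fin n → ℝ) : State (Fin b) :=
  fun y => ∑ j, if enc b j = y then (v j : ℂ) else 0

/-- The amplitude, at the basis label `(x, y)`, of the unnormalized vector
`∑ i j, M i j |i⟩|j⟩`. -/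
def ketMat {m n : ℕ} (b c : ℕ) (M : Matrix (Fin m) (Fin n) ℝ)
    (x : Bits (Fin b)) (y : Bits (Fin c)) : ℂ :=
  ∑ i, ∑ j, if enc b i = x ∧ enc c j = y then (M i j : ℂ) else 0

/-! ### Matrices as quantum data -/

/-- The Euclidean norm of the `i`-th row. -/
def rowNorm {m n : ℕ} (M : Matrix (Fin m) (Fin n) ℝ) (i : Fin m) : ℝ :=
  ‖(WithLp.toLp 2 (M i) : EuclideanSpace ℝ (Fin n))‖

/-- The condition number: the largest singular value divided by the smallest nonzero one
(singular values are listed in decreasing order, the first `M.rank` of them are the nonzero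
ones). -/
def condNumber {m n : ℕ} (M : Matrix (Fin m) (Fin n) ℝ) : ℝ :=
  (Matrix.toEuclideanLin M).singularValues 0 /
    (Matrix.toEuclideanLin M).singularValues (M.rank - 1)

/-- The unitaries by which an algorithm accesses `A` (whose row and column indices have `p` and
`q` bits) and `B` (whose row and column indices have `q` and `r` bits). -/
structure Access (p q r : ℕ) where
  rowPrep : Matrix.unitaryGroup (Bits (Fin p ⊕ Fin q)) ℂ
  normPrep : Matrix.unitaryGroup (Bits (Fin p ⊕ Fin q)) ℂ
  matPrep : Matrix.unitaryGroup (Bits (Fin q ⊕ Fin r)) ℂ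

/-- `U : |i⟩|0⟩ ↦ |i⟩|Aᵢ⟩`, with `|Aᵢ⟩` the normalization of the `i`-th row of `A`. When the row
is zero, or when the label is not the code of a row, `|Aᵢ⟩` may be any unit vector. -/
def PreparesRows {l m : ℕ} (p q : ℕ) (A : Matrix (Fin l) (Fin m) ℝ)
    (U : Matrix (Bits (Fin p ⊕ Fin q)) (Bits (Fin p ⊕ Fin q)) ℂ) : Prop :=
  ∀ x : Bits (Fin p), ∃ φ : State (Fin q),
    (∀ x' y, U (Sum.elim x' y) (Sum.elim x (zeros _)) = if x' = x then φ y else 0) ∧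
    ∀ i : Fin l, enc p i = x → ∀ y, (rowNorm A i : ℂ) * φ y = ketVec q (A i) y

/-- `U : |0⟩|j⟩ ↦ |A_F⟩|j⟩`, where `|A_F⟩ = ‖A‖_F⁻¹ ∑ i, ‖Aᵢ‖ |i⟩`. -/
def PreparesNorms {l m : ℕ} (p q : ℕ) (A : Matrix (Fin l) (Fin m) ℝ)
    (U : Matrix (Bits (Fin p ⊕ Fin q)) (Bits (Fin p ⊕ Fin q)) ℂ) : Prop :=
  ∀ (y : Bits (Fin q)) (x' : Bits (Fin p)) (y' : Bits (Fin q)),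
    U (Sum.elim x' y') (Sum.elim (zeros _) y) =
      if y' = y then ketVec p (rowNorm A) x' / (‖A‖ : ℂ) else 0

/-- `U : |0⟩|0⟩ ↦ |B⟩ = ‖B‖_F⁻¹ ∑ j k, B j k |j⟩|k⟩`. -/
def PreparesMatrix {m n : ℕ} (q r : ℕ) (B : Matrix (Fin m) (Fin n) ℝ)
    (U : Matrix (Bits (Fin q ⊕ Fin r)) (Bits (Fin q ⊕ Fin r)) ℂ) : Prop :=
  ∀ (x : Bits (Fin q)) (y : Bits (Fin r)),
    U (Sum.elim x y) (Sum.elim (zeros _) (zeros _)) = ketMat q r B x y / (‖B‖ : ℂ)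

/-- The access unitaries hold the quantum data of `A` and `B`. -/
structure Access.Encodes {p q r l m n : ℕ} (O : Access p q r)
    (A : Matrix (Fin l) (Fin m) ℝ) (B : Matrix (Fin m) (Fin n) ℝ) : Prop where
  rows : PreparesRows p q A O.rowPrep
  norms : PreparesNorms p q A O.normPrep
  matrix : PreparesMatrix q r B O.matPrep

/-! ### Quantum circuits with access gates -/

/-- Apply the operator `U` to the qubits `e i`, `i : ι`, and the identity to all others. -/
def applyOn {ι W : Type} [Fintype ι] [DecidableEq ι] (e : ι ↪ W)
    (U : Matrix (Bits ι) (Bits ι) ℂ) (ψ : State W) : State W :=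
  fun x => ∑ y : Bits ι, U (x ∘ e) y * ψ (Function.extend e y x)

/-- The NOT gate. -/
def matX : Matrix (Bits (Fin 1)) (Bits (Fin 1)) ℂ :=
  fun x y => if x 0 = !(y 0) then 1 else 0

/-- The Hadamard gate. -/
def matH : Matrix (Bits (Fin 1)) (Bits (Fin 1)) ℂ :=
  fun x y => (if x 0 && y 0 then -1 else 1) / (√2 : ℝ)

/-- The `T` gate `diag(1, exp(iπ/4))`. -/
def matT : Matrix (Bits (Fin 1)) (Bits (Fin 1)) ℂ :=
  Matrix.diagonal fun x => if x 0 then Complex.exp (Complex.I * Real.pi / 4) else 1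

/-- The controlled NOT gate; qubit `0` is the control. -/
def matCNOT : Matrix (Bits (Fin 2)) (Bits (Fin 2)) ℂ :=
  fun x y => if x 0 = y 0 ∧ x 1 = (y 1 ^^ y 0) then 1 else 0

/-- The Toffoli gate; qubits `0` and `1` are the controls. -/
def matToffoli : Matrix (Bits (Fin 3)) (Bits (Fin 3)) ℂ :=
  fun x y => if x 0 = y 0 ∧ x 1 = y 1 ∧ x 2 = (y 2 ^^ (y 0 && y 1)) then 1 else 0

/-- Gates on the qubits in `W`: elementary gates, and the access unitaries and their inverses,
on any choice of distinct qubits. -/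
inductive Gate (p q r : ℕ) (W : Type) : Type
  | X (e : Fin 1 ↪ W)
  | H (e : Fin 1 ↪ W)
  | T (e : Fin 1 ↪ W)
  | CNOT (e : Fin 2 ↪ W)
  | Toffoli (e : Fin 3 ↪ W)
  | rowPrep (e : Fin p ⊕ Fin q ↪ W)
  | rowPrepInv (e : Fin p ⊕ Fin q ↪ W)
  | normPrep (e : Fin p ⊕ Fin q ↪ W)
  | normPrepInv (e : Fin p ⊕ Fin q ↪ W)
  | matPrep (e : Fin q ⊕ Fin r ↪ W)
  | matPrepInv (e : Fin q ⊕ Fin r ↪ W)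

/-- The action of a gate on a state. -/
def Gate.act {p q r : ℕ} {W : Type} (O : Access p q r) : Gate p q r W → State W → State W
  | .X e => applyOn e matX
  | .H e => applyOn e matH
  | .T e => applyOn e matT
  | .CNOT e => applyOn e matCNOT
  | .Toffoli e => applyOn e matToffoli
  | .rowPrep e => applyOn e (O.rowPrep : Matrix _ _ ℂ)
  | .rowPrepInv e => applyOn e (star (O.rowPrep : Matrix _ _ ℂ))
  | .normPrep e => applyOn e (O.normPrep : Matrix _ _ ℂ)
  | .normPrepInv e => applyOn e (star (O.normPrep : Matrix _ _ ℂ))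
  | .matPrep e => applyOn e (O.matPrep : Matrix _ _ ℂ)
  | .matPrepInv e => applyOn e (star (O.matPrep : Matrix _ _ ℂ))

/-- The time of a gate: `1` for an elementary gate, `τ` for a state preparation. -/
def Gate.time {p q r : ℕ} {W : Type} (τ : ℝ) : Gate p q r W → ℝ
  | .X _ => 1
  | .H _ => 1
  | .T _ => 1
  | .CNOT _ => 1
  | .Toffoli _ => 1
  | .rowPrep _ => τ
  | .rowPrepInv _ => τ
  | .normPrep _ => τ
  | .normPrepInv _ => τ
  | .matPrep _ => τ
  | .matPrepInv _ => τ

/-- The qubits of a circuit, in this order: the two registers `p`, `r` of the output `|i⟩|k⟩`, a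
register of `q` qubits, the flag qubit and `s` further ancilla qubits. -/
abbrev Wires (p q r s : ℕ) : Type := Fin p ⊕ Fin r ⊕ Fin q ⊕ Unit ⊕ Fin s

/-- The flag qubit. -/
def flag {p q r s : ℕ} : Wires p q r s := Sum.inr (Sum.inr (Sum.inr (Sum.inl ())))

/-- One round of an algorithm: a circuit (a list of gates, the first one acting first), run on
qubits that are all initialized in `|0⟩`, after which the flag is measured. The round succeeds
when the outcome is `1`. -/
structure Round (p q r : ℕ) where
  ancillas : ℕ
  circuit : List (Gate p q r (Wires p q r ancillas))

namespace Round

variable {p q r : ℕ}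

/-- The state before the measurement. -/
def finalState (R : Round p q r) (O : Access p q r) : State (Wires p q r R.ancillas) :=
  R.circuit.foldl (fun ψ g => g.act O ψ) (ketZero _)

/-- The component of the final state with flag `1`, not normalized. -/
def successPart (R : Round p q r) (O : Access p q r) : State (Wires p q r R.ancillas) :=
  fun x => if x flag then R.finalState O x else 0

/-- The probability that the round succeeds. -/
def successProb (R : Round p q r) (O : Access p q r) : ℝ :=
  stateNorm (R.successPart O) ^ 2

/-- The state after a successful measurement (relevant when the probability of success is
nonzero). -/
def outputState (R : Round p q r) (O : Access p q r) : State (Wires p q r R.ancillas) :=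
  ((stateNorm (R.successPart O) : ℂ))⁻¹ • R.successPart O

/-- The time of a round: its gates and its measurement. -/
def time (R : Round p q r) (τ : ℝ) : ℝ :=
  (R.circuit.map (Gate.time τ)).sum + 1

end Round

/-- The quantum state `|M⟩ = ‖M‖_F⁻¹ ∑ i k, M i k |i⟩|k⟩` in the output registers, with flag `1`
and all other qubits in `|0⟩`. -/
def targetState {l n : ℕ} (p q r s : ℕ) (M : Matrix (Fin l) (Fin n) ℝ) :
    State (Wires p q r s) :=
  fun x =>
    if (∀ t, x (Sum.inr (Sum.inr (Sum.inl t))) = false) ∧ x flag = true ∧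
        ∀ t, x (Sum.inr (Sum.inr (Sum.inr (Sum.inr t)))) = false
    then ketMat p r M (fun t => x (Sum.inl t)) (fun t => x (Sum.inr (Sum.inl t))) / (‖M‖ : ℂ)
    else 0

/-- The state `ψ` equals `χ` to precision `ε`, up to a global phase. -/
def IsClose {W : Type} [Fintype W] [DecidableEq W] (ε : ℝ) (ψ χ : State W) : Prop :=
  ∃ c : ℂ, ‖c‖ = 1 ∧ stateNorm (ψ - c • χ) ≤ ε

/-- An algorithm for the product of an `l × m` and an `m × n` matrix: it performs the rounds
`0, 1, 2, …` one after the other, until the first one that succeeds, and returns the state after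
the measurement of that round. -/
abbrev Algorithm (l m n : ℕ) : Type :=
  ℕ → Round (Nat.clog 2 l) (Nat.clog 2 m) (Nat.clog 2 n)

namespace Algorithm

variable {l m n : ℕ}

/-- The probability that one of the first `K` rounds succeeds. -/
def successProb (alg : Algorithm l m n)
    (O : Access (Nat.clog 2 l) (Nat.clog 2 m) (Nat.clog 2 n)) (K : ℕ) : ℝ :=
  1 - ∏ j ∈ Finset.range K, (1 - (alg j).successProb O)

/-- The total time of the first `K` rounds, when a state preparation takes time `τ`. -/
def time (alg : Algorithm l m n) (τ : ℝ) (K : ℕ) : ℝ :=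
  ∑ j ∈ Finset.range K, (alg j).time τ

end Algorithm

end QMatMul

end

/-! Prepare `|B⟩` on the middle and right registers and `|A_F⟩` on the left one, then apply the
inverse row preparation. The amplitude at `|i⟩|k⟩` with middle register zero is `‖Aᵢ‖ ⟨Aᵢ|B_k⟩ /
(‖A‖‖B‖)`, where `B_k` is the `k`-th column of `B`. This equals `(AB)ᵢₖ / (‖A‖‖B‖)`, so the
component with zero middle register is exactly `s • |AB⟩` with `s = ‖AB‖ / (‖A‖‖B‖)`
(`run_prep_label`, `middleZero_amplified_zero`).

Write `s = sin θ`. One step of amplitude amplification turns a preparation `c` into `c`, a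
reflection in the middle register, `c⁻¹`, a reflection in `|0⟩`, and `c` again. It multiplies the
good component by a real scalar and replaces `sin θ` by `± sin 3θ` (`middleZero_amplified_succ`).
After `e` steps a round succeeds with probability `sin² (3 ^ e θ)` and costs `O(3 ^ e)`
preparations. The output is `|AB⟩` up to sign, with no error.

Since `θ` is unknown, the levels `e = 0, 1, 2, …` are tried in turn, each `O(1 + log (1/δ))` times.
At the first level `E` with `3 ^ E θ ≥ π/6` the angle is still at most `π/2`, so each try succeeds
with probability at least `1/4`, while `3 ^ E ≤ 2 / s` (`exists_pow_sin_sq_ge`). The costs form a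
geometric series dominated by level `E`, of order `1 / s` up to logarithms. As `κ ≥ 1` and `ε ≤ 1`,
this lies below the claimed bound. -/

noncomputable section

namespace QMatMul

/-! ### Operators on some of the qubits -/

section ApplyOn

variable {ι W : Type}

lemma extend_comp_emb (e : ι ↪ W) (y : Bits ι) (x : Bits W) :
    Function.extend e y x ∘ e = y :=
  Function.extend_comp e.injective y x

lemma extend_extend (e : ι ↪ W) (y y' : Bits ι) (x : Bits W) :
    Function.extend e y' (Function.extend e y x) = Function.extend e y' x := by
  funext v
  by_cases h : ∃ i, e i = v
  · obtain ⟨i, rfl⟩ := h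
    simp [e.injective.extend_apply]
  · simp [Function.extend_apply' _ _ _ h]

lemma extend_self_comp (e : ι ↪ W) (x : Bits W) : Function.extend e (x ∘ e) x = x := by
  funext v
  by_cases h : ∃ i, e i = v
  · obtain ⟨i, rfl⟩ := h
    simp [e.injective.extend_apply]
  · simp [Function.extend_apply' _ _ _ h]

lemma extend_apply_of_eq (e : ι ↪ W) (y : Bits ι) (x : Bits W) {i : ι} {v : W} (h : e i = v) :
    Function.extend e y x v = y i :=
  h ▸ e.injective.extend_apply y x i

variable [Fintype ι] [DecidableEq ι]

lemma applyOn_one (e : ι ↪ W) (ψ : State W) : applyOn e 1 ψ = ψ := by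
  funext x
  simp [applyOn, Matrix.one_apply, extend_self_comp]

lemma applyOn_applyOn (e : ι ↪ W) (U V : Matrix (Bits ι) (Bits ι) ℂ) (ψ : State W) :
    applyOn e U (applyOn e V ψ) = applyOn e (U * V) ψ := by
  funext x
  simp only [applyOn, extend_comp_emb, extend_extend, Matrix.mul_apply, Finset.mul_sum,
    Finset.sum_mul]
  rw [Finset.sum_comm]
  simp only [mul_assoc]

lemma applyOn_sub (e : ι ↪ W) (U : Matrix (Bits ι) (Bits ι) ℂ) (φ ψ : State W) :
    applyOn e U (φ - ψ) = applyOn e U φ - applyOn e U ψ := by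
  funext x
  simp [applyOn, mul_sub]

lemma applyOn_smul (e : ι ↪ W) (U : Matrix (Bits ι) (Bits ι) ℂ) (c : ℂ) (ψ : State W) :
    applyOn e U (c • ψ) = c • applyOn e U ψ := by
  funext x
  simp only [applyOn, Pi.smul_apply, smul_eq_mul, Finset.mul_sum]
  exact Finset.sum_congr rfl fun y _ => by ring

lemma applyOn_permutation (e : ι ↪ W) {U : Matrix (Bits ι) (Bits ι) ℂ} (f : Bits ι → Bits ι)
    (hU : ∀ x y, U x y = if y = f x then 1 else 0) (ψ : State W) (x : Bits W) :
    applyOn e U ψ x = ψ (Function.extend e (f (x ∘ e)) x) := by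
  simp [applyOn, hU]

lemma applyOn_diagonal (e : ι ↪ W) (d : Bits ι → ℂ) (ψ : State W) (x : Bits W) :
    applyOn e (Matrix.diagonal d) ψ x = d (x ∘ e) * ψ x := by
  simp [applyOn, Matrix.diagonal_apply, extend_self_comp]

end ApplyOn

/-! ### Inner products -/

/-- The inner product of two amplitude vectors. -/
def ip {W : Type} [Fintype W] [DecidableEq W] (φ χ : State W) : ℂ :=
  ∑ x, star (φ x) * χ x

section InnerProduct

variable {W : Type} [Fintype W] [DecidableEq W]

lemma ip_sub_right (φ χ ξ : State W) : ip φ (χ - ξ) = ip φ χ - ip φ ξ := by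
  simp [ip, mul_sub]

lemma ip_smul_right (φ χ : State W) (c : ℂ) : ip φ (c • χ) = c * ip φ χ := by
  simp only [ip, Pi.smul_apply, smul_eq_mul, Finset.mul_sum]
  exact Finset.sum_congr rfl fun y _ => by ring

lemma ip_ketZero_left (χ : State W) : ip (ketZero W) χ = χ (zeros W) := by
  simp [ip, ketZero]

lemma stateNorm_sq (ψ : State W) : stateNorm ψ ^ 2 = ∑ x, ‖ψ x‖ ^ 2 := by
  simp [stateNorm, EuclideanSpace.norm_sq_eq]

lemma stateNorm_smul (c : ℂ) (ψ : State W) : stateNorm (c • ψ) = ‖c‖ * stateNorm ψ := by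
  simp [stateNorm, norm_smul]

lemma ip_self (ψ : State W) : ip ψ ψ = ((∑ x, ‖ψ x‖ ^ 2 : ℝ) : ℂ) := by
  simp only [ip, Complex.ofReal_sum, Complex.ofReal_pow]
  exact Finset.sum_congr rfl fun x _ => Complex.conj_mul' _

/-- Both sides are sums over pairs of a full label `x` and a local label `y`. Exchanging `y` with
the bits of `x` on `e` is an involution of such pairs that matches the terms. -/
lemma ip_applyOn {ι : Type} [Fintype ι] [DecidableEq ι] (e : ι ↪ W)
    (U : Matrix (Bits ι) (Bits ι) ℂ) (φ χ : State W) :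
    ip (applyOn e U φ) χ = ip φ (applyOn e (star U) χ) := by
  simp only [ip, applyOn, star_sum, Finset.sum_mul, Finset.mul_sum, ← Fintype.sum_prod_type']
  refine Finset.sum_nbij' (fun z => (Function.extend e z.2 z.1, z.1 ∘ e))
    (fun z => (Function.extend e z.2 z.1, z.1 ∘ e)) (by simp) (by simp) ?_ ?_ ?_
  · rintro ⟨x, y⟩ _
    simp [extend_comp_emb, extend_extend, extend_self_comp]
  · rintro ⟨x, y⟩ _
    simp [extend_comp_emb, extend_extend, extend_self_comp]
  · rintro ⟨x, y⟩ _
    simp only [extend_comp_emb, extend_extend, extend_self_comp, Matrix.star_apply, star_mul']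
    ring

end InnerProduct

/-! ### Circuits -/

section Circuit

variable {p q r : ℕ} {W : Type}

/-- The action of a circuit, its first gate acting first. -/
def run (O : Access p q r) (c : List (Gate p q r W)) (ψ : State W) : State W :=
  c.foldl (fun ψ g => g.act O ψ) ψ

/-- The total time of the gates of a circuit. -/
def gateTime (τ : ℝ) (c : List (Gate p q r W)) : ℝ := (c.map (Gate.time τ)).sum

@[simp] lemma run_nil (O : Access p q r) (ψ : State W) : run O [] ψ = ψ := rfl

@[simp] lemma run_cons (O : Access p q r) (g : Gate p q r W) (c : List (Gate p q r W))
    (ψ : State W) : run O (g :: c) ψ = run O c (g.act O ψ) := rfl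

lemma run_append (O : Access p q r) (c d : List (Gate p q r W)) (ψ : State W) :
    run O (c ++ d) ψ = run O d (run O c ψ) := by
  simp [run]

@[simp] lemma gateTime_nil (τ : ℝ) : gateTime τ ([] : List (Gate p q r W)) = 0 := rfl

@[simp] lemma gateTime_cons (τ : ℝ) (g : Gate p q r W) (c : List (Gate p q r W)) :
    gateTime τ (g :: c) = g.time τ + gateTime τ c := by
  simp [gateTime]

@[simp] lemma gateTime_append (τ : ℝ) (c d : List (Gate p q r W)) :
    gateTime τ (c ++ d) = gateTime τ c + gateTime τ d := by
  simp [gateTime]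

lemma exists_act_eq_applyOn (O : Access p q r) (g : Gate p q r W) :
    ∃ (ι : Type) (_ : Fintype ι) (_ : DecidableEq ι) (e : ι ↪ W)
      (U : Matrix (Bits ι) (Bits ι) ℂ), g.act O = applyOn e U := by
  cases g <;> exact ⟨_, _, _, _, _, rfl⟩

lemma run_sub (O : Access p q r) (c : List (Gate p q r W)) (φ ψ : State W) :
    run O c (φ - ψ) = run O c φ - run O c ψ := by
  induction c generalizing φ ψ with
  | nil => rfl
  | cons g c ih =>
    obtain ⟨ι, _, _, e, U, h⟩ := exists_act_eq_applyOn O g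
    simp [h, applyOn_sub, ih]

lemma run_smul (O : Access p q r) (c : List (Gate p q r W)) (z : ℂ) (ψ : State W) :
    run O c (z • ψ) = z • run O c ψ := by
  induction c generalizing ψ with
  | nil => rfl
  | cons g c ih =>
    obtain ⟨ι, _, _, e, U, h⟩ := exists_act_eq_applyOn O g
    simp [h, applyOn_smul, ih]

/-- The circuits `c` and `d` act as operators that are inverse and adjoint to each other. -/
structure InversePair [Fintype W] [DecidableEq W] (O : Access p q r)
    (c d : List (Gate p q r W)) : Prop where
  left : ∀ ψ, run O d (run O c ψ) = ψ
  right : ∀ ψ, run O c (run O d ψ) = ψ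
  adjoint : ∀ φ χ, ip (run O c φ) χ = ip φ (run O d χ)

lemma InversePair.append [Fintype W] [DecidableEq W] {O : Access p q r}
    {c d c' d' : List (Gate p q r W)} (h : InversePair O c d) (h' : InversePair O c' d') :
    InversePair O (c ++ c') (d' ++ d) where
  left ψ := by simp [run_append, h.left, h'.left]
  right ψ := by simp [run_append, h.right, h'.right]
  adjoint φ χ := by simp [run_append, h.adjoint, h'.adjoint]

lemma inversePair_of_unitary [Fintype W] [DecidableEq W] {ι : Type} [Fintype ι] [DecidableEq ι]
    {O : Access p q r} {g g' : Gate p q r W} (e : ι ↪ W) {U : Matrix (Bits ι) (Bits ι) ℂ}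
    (hU : U ∈ Matrix.unitaryGroup (Bits ι) ℂ) (hg : g.act O = applyOn e U)
    (hg' : g'.act O = applyOn e (star U)) : InversePair O [g] [g'] where
  left ψ := by
    simp [hg, hg', applyOn_applyOn, Matrix.mem_unitaryGroup_iff'.1 hU, applyOn_one]
  right ψ := by
    simp [hg, hg', applyOn_applyOn, Matrix.mem_unitaryGroup_iff.1 hU, applyOn_one]
  adjoint φ χ := by simp [hg, hg', ip_applyOn]

/-- The state vanishes on the basis labels with a `1` at some qubit in `N`. -/
def Clean (N : Set W) (ψ : State W) : Prop := ∀ x, (∃ v ∈ N, x v = true) → ψ x = 0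

lemma clean_ketZero [Fintype W] (N : Set W) : Clean N (ketZero W) := by
  rintro x ⟨v, -, hv⟩
  have : x ≠ zeros W := by rintro rfl; simp [zeros] at hv
  simp [ketZero, this]

lemma Clean.applyOn {ι : Type} [Fintype ι] [DecidableEq ι] {N : Set W} {ψ : State W}
    (h : Clean N ψ) (e : ι ↪ W) (U : Matrix (Bits ι) (Bits ι) ℂ) (he : ∀ i, e i ∉ N) :
    Clean N (applyOn e U ψ) := by
  rintro x ⟨v, hv, hxv⟩
  refine Finset.sum_eq_zero fun y _ => ?_
  rw [h _ ⟨v, hv, ?_⟩, mul_zero]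
  rwa [Function.extend_apply' _ _ _ (by rintro ⟨i, rfl⟩; exact he i hv)]

/-- The circuit `c` permutes the computational basis: it acts by composition with `f`. -/
def Permutes (O : Access p q r) (c : List (Gate p q r W)) (f : Bits W → Bits W) : Prop :=
  ∀ ψ, run O c ψ = ψ ∘ f

/-- Circuits act by pullback, so the maps compose in the order in which the gates are listed, and
labels themselves move by the inverse maps. Hence a circuit that computes forwards pulls back along
the undoing map. -/
lemma Permutes.append {O : Access p q r} {c d : List (Gate p q r W)} {f g : Bits W → Bits W}
    (hc : Permutes O c f) (hd : Permutes O d g) : Permutes O (c ++ d) (f ∘ g) := by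
  intro ψ
  rw [run_append, hc, hd, Function.comp_assoc]

lemma permutes_nil (O : Access p q r) : Permutes O ([] : List (Gate p q r W)) id :=
  fun _ => rfl

/-- The embedding of one qubit. -/
def embOne (a : W) : Fin 1 ↪ W := ⟨fun _ => a, fun _ _ _ => Subsingleton.elim _ _⟩

/-- The sign gate `diag(1, -1)` on the qubit `a`. -/
def signGate (a : W) : List (Gate p q r W) := List.replicate 4 (Gate.T (embOne a))

lemma run_signGate (O : Access p q r) (a : W) (ψ : State W) (x : Bits W) :
    run O (signGate a) ψ x = (if x a then -1 else 1) * ψ x := by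
  have h : ∀ φ : State W, ∀ x, (Gate.T (embOne a)).act O φ x =
      (if x a then Complex.exp (Complex.I * Real.pi / 4) else 1) * φ x := by
    intro φ x
    simp only [Gate.act, matT]
    rw [applyOn_diagonal]
    rfl
  simp only [signGate, List.replicate, run_cons, run_nil, h]
  split_ifs
  -- Four `T` phases multiply to `exp(iπ) = -1`.
  · rw [← mul_assoc, ← mul_assoc, ← mul_assoc, ← Complex.exp_add, ← Complex.exp_add,
      ← Complex.exp_add, show (Complex.I * Real.pi / 4 + Complex.I * Real.pi / 4 +
        Complex.I * Real.pi / 4 + Complex.I * Real.pi / 4 : ℂ) = Real.pi * Complex.I by ring,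
      Complex.exp_pi_mul_I]
  · simp

/-! ### Elementary gates as permutations of basis labels -/

variable [DecidableEq W]

/-- The embedding of two distinct qubits. -/
def embTwo (a b : W) (h : a ≠ b) : Fin 2 ↪ W :=
  ⟨![a, b], by
    intro i j hij
    fin_cases i <;> fin_cases j <;> simp_all [eq_comm]⟩

/-- The embedding of three distinct qubits. -/
def embThree (a b c : W) (h : a ≠ b ∧ a ≠ c ∧ b ≠ c) : Fin 3 ↪ W :=
  ⟨![a, b, c], by
    obtain ⟨h1, h2, h3⟩ := h
    intro i j hij
    fin_cases i <;> fin_cases j <;> simp_all [eq_comm]⟩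

lemma permutes_X (O : Access p q r) (a : W) :
    Permutes O [Gate.X (embOne a)] fun x => Function.update x a (!x a) := by
  intro ψ
  funext x
  simp only [run_cons, run_nil, Gate.act, Function.comp_apply]
  rw [applyOn_permutation _ (fun y => fun _ => !y 0)]
  · congr 1
    funext v
    by_cases hv : v = a
    · subst hv
      rw [extend_apply_of_eq (embOne v) _ _ (i := 0) (v := v) rfl]
      simp [embOne, DFunLike.coe]
    · rw [Function.extend_apply' _ _ _ (by rintro ⟨i, rfl⟩; exact hv rfl)]
      simp [hv]
  · intro x y
    have : x 0 = (!y 0) ↔ y = fun _ => !x 0 := by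
      constructor
      · intro h; funext i; rw [Subsingleton.elim i 0, h]; simp
      · intro h; rw [h]; simp
    simp [matX, this]

/-- A controlled NOT gate (no gate at all when the two qubits are equal). -/
def cnot (a b : W) : List (Gate p q r W) :=
  if h : a ≠ b then [Gate.CNOT (embTwo a b h)] else []

lemma permutes_cnot (O : Access p q r) {a b : W} (h : a ≠ b) :
    Permutes O (cnot a b) fun x => Function.update x b (x b ^^ x a) := by
  intro ψ
  funext x
  simp only [cnot, dif_pos h, run_cons, run_nil, Gate.act, Function.comp_apply]
  rw [applyOn_permutation _ (fun y => ![y 0, y 1 ^^ y 0])]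
  · congr 1
    funext v
    by_cases hb : v = b
    · subst hb
      rw [extend_apply_of_eq (embTwo a v h) _ _ (i := 1) (v := v) rfl]
      simp [embTwo, DFunLike.coe]
    by_cases ha : v = a
    · subst ha
      rw [extend_apply_of_eq (embTwo v b h) _ _ (i := 0) (v := v) rfl]
      simp [embTwo, hb, DFunLike.coe]
    · rw [Function.extend_apply']
      · simp [hb]
      · rintro ⟨i, rfl⟩
        fin_cases i
        exacts [ha rfl, hb rfl]
  · intro x y
    have : (x 0 = y 0 ∧ x 1 = (y 1 ^^ y 0)) ↔ y = ![x 0, x 1 ^^ x 0] := by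
      constructor
      · rintro ⟨h0, h1⟩; funext i; fin_cases i <;> simp [h0, h1]
      · intro h; rw [h]; simp
    simp only [matCNOT, this]

/-- A Toffoli gate (no gate at all when the three qubits are not distinct). -/
def toffoli (a b c : W) : List (Gate p q r W) :=
  if h : a ≠ b ∧ a ≠ c ∧ b ≠ c then [Gate.Toffoli (embThree a b c h)] else []

lemma permutes_toffoli (O : Access p q r) {a b c : W} (h : a ≠ b ∧ a ≠ c ∧ b ≠ c) :
    Permutes O (toffoli a b c) fun x => Function.update x c (x c ^^ (x a && x b)) := by
  intro ψ
  funext x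
  simp only [toffoli, dif_pos h, run_cons, run_nil, Gate.act, Function.comp_apply]
  rw [applyOn_permutation _ (fun y => ![y 0, y 1, y 2 ^^ (y 0 && y 1)])]
  · congr 1
    funext v
    by_cases hc : v = c
    · subst hc
      rw [extend_apply_of_eq (embThree a b v h) _ _ (i := 2) (v := v) rfl]
      simp [embThree]
    by_cases hb : v = b
    · subst hb
      rw [extend_apply_of_eq (embThree a v c h) _ _ (i := 1) (v := v) rfl]
      simp [embThree, hc]
    by_cases ha : v = a
    · subst ha
      rw [extend_apply_of_eq (embThree v b c h) _ _ (i := 0) (v := v) rfl]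
      simp [embThree, hc]
    · rw [Function.extend_apply']
      · simp [hc]
      · rintro ⟨i, rfl⟩
        fin_cases i
        exacts [ha rfl, hb rfl, hc rfl]
  · intro x y
    have : (x 0 = y 0 ∧ x 1 = y 1 ∧ x 2 = (y 2 ^^ (y 0 && y 1))) ↔
        y = ![x 0, x 1, x 2 ^^ (x 0 && x 1)] := by
      constructor
      · rintro ⟨h0, h1, h2⟩; funext i; fin_cases i <;> simp [h0, h1, h2]
      · intro h; rw [h]; simp
    simp only [matToffoli, this]

end Circuit

/-! ### Conjunctions computed into ancillas -/

section Conjunction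

variable {p q r : ℕ} {W : Type}

/-- The ancillas `a 0, …, a K` are distinct, and no qubit of `ws` is an ancilla. -/
structure Ancillas (a : ℕ → W) (K : ℕ) (ws : List W) : Prop where
  inj : ∀ i j, i ≤ K → j ≤ K → a i = a j → i = j
  ne : ∀ w ∈ ws, ∀ j, w ≠ a j

lemma Ancillas.tail {a : ℕ → W} {K : ℕ} {w : W} {ws : List W} (h : Ancillas a K (w :: ws)) :
    Ancillas a K ws :=
  ⟨h.inj, fun v hv => h.ne v (List.mem_cons_of_mem _ hv)⟩

lemma Ancillas.distinct {a : ℕ → W} {K : ℕ} {w : W} {ws : List W}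
    (h : Ancillas a K (w :: ws)) {i : ℕ} (hi : i + 1 ≤ K) :
    w ≠ a i ∧ w ≠ a (i + 1) ∧ a i ≠ a (i + 1) :=
  ⟨h.ne w (by simp) _, h.ne w (by simp) _, fun h' => by
    have := h.inj _ _ (by omega) hi h'
    omega⟩

variable [DecidableEq W]

/-- Add `¬ w ∧ a` to the qubit `b`. -/
def andStep (w a b : W) (x : Bits W) : Bits W :=
  Function.update x b (x b ^^ (!x w && x a))

lemma andStep_andStep {w a b : W} (hw : w ≠ b) (ha : a ≠ b) (x : Bits W) :
    andStep w a b (andStep w a b x) = x := by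
  simp [andStep, hw, ha]

lemma andStep_of_ne {w a b v : W} (h : v ≠ b) (x : Bits W) : andStep w a b x v = x v := by
  simp [andStep, h]

lemma andStep_update {w a b f : W} (hw : w ≠ f) (ha : a ≠ f) (hb : b ≠ f) (x : Bits W)
    (t : Bool) :
    andStep w a b (Function.update x f t) = Function.update (andStep w a b x) f t := by
  simp only [andStep, Function.update_of_ne hw, Function.update_of_ne ha,
    Function.update_of_ne hb]
  rw [Function.update_comm hb]

/-- The circuit for `andStep`. -/
def andStepCircuit (w a b : W) : List (Gate p q r W) :=
  [Gate.X (embOne w)] ++ (toffoli w a b ++ [Gate.X (embOne w)])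

lemma permutes_andStepCircuit (O : Access p q r) {w a b : W} (h : w ≠ a ∧ w ≠ b ∧ a ≠ b) :
    Permutes O (andStepCircuit w a b) (andStep w a b) := by
  intro ψ
  rw [andStepCircuit, (permutes_X O w).append ((permutes_toffoli O h).append (permutes_X O w)) ψ]
  congr 1
  funext x
  funext v
  by_cases hb : v = b
  · subst hb
    simp [andStep, h.1.symm, h.2.1, h.2.1.symm]
  · by_cases hw : v = w
    · subst hw
      simp [andStep, hb]
    · simp [andStep, hb, hw]

lemma gateTime_andStepCircuit_le (τ : ℝ) (w a b : W) :
    gateTime τ (andStepCircuit w a b : List (Gate p q r W)) ≤ 3 := by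
  unfold andStepCircuit toffoli
  split_ifs <;> norm_num [Gate.time]

/-- Run the steps that compute `a i ∧ ¬ w₁ ∧ ¬ w₂ ∧ …` into the ancillas after `a i`. -/
def andRun (a : ℕ → W) : List W → ℕ → Bits W → Bits W
  | [], _, x => x
  | w :: ws, i, x => andRun a ws (i + 1) (andStep w (a i) (a (i + 1)) x)

/-- Undo `andRun`. -/
def andUndo (a : ℕ → W) : List W → ℕ → Bits W → Bits W
  | [], _, x => x
  | w :: ws, i, x => andStep w (a i) (a (i + 1)) (andUndo a ws (i + 1) x)

/-- The circuit that composes states with `andUndo`. -/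
def andCircuit (a : ℕ → W) : List W → ℕ → List (Gate p q r W)
  | [], _ => []
  | w :: ws, i => andStepCircuit w (a i) (a (i + 1)) ++ andCircuit a ws (i + 1)

/-- The circuit that composes states with `andRun`. -/
def andCircuitInv (a : ℕ → W) : List W → ℕ → List (Gate p q r W)
  | [], _ => []
  | w :: ws, i => andCircuitInv a ws (i + 1) ++ andStepCircuit w (a i) (a (i + 1))

lemma gateTime_andCircuit_le (τ : ℝ) (a : ℕ → W) (ws : List W) (i : ℕ) :
    gateTime τ (andCircuit a ws i : List (Gate p q r W)) ≤ 3 * ws.length := by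
  induction ws generalizing i with
  | nil => simp [andCircuit]
  | cons w ws ih =>
    have h1 := gateTime_andStepCircuit_le (p := p) (q := q) (r := r) τ w (a i) (a (i + 1))
    have h2 := ih (i + 1)
    simp only [andCircuit, gateTime_append, List.length_cons, Nat.cast_add, Nat.cast_one]
    linarith

lemma gateTime_andCircuitInv_le (τ : ℝ) (a : ℕ → W) (ws : List W) (i : ℕ) :
    gateTime τ (andCircuitInv a ws i : List (Gate p q r W)) ≤ 3 * ws.length := by
  induction ws generalizing i with
  | nil => simp [andCircuitInv]
  | cons w ws ih =>
    have h1 := gateTime_andStepCircuit_le (p := p) (q := q) (r := r) τ w (a i) (a (i + 1))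
    have h2 := ih (i + 1)
    simp only [andCircuitInv, gateTime_append, List.length_cons, Nat.cast_add, Nat.cast_one]
    linarith

lemma permutes_andCircuit (O : Access p q r) {a : ℕ → W} {K : ℕ} {ws : List W} {i : ℕ}
    (h : Ancillas a K ws) (hi : i + ws.length ≤ K) :
    Permutes O (andCircuit a ws i) (andUndo a ws i) := by
  induction ws generalizing i with
  | nil => exact permutes_nil O
  | cons w ws ih =>
    rw [List.length_cons] at hi
    exact (permutes_andStepCircuit O (h.distinct (by omega))).append (ih h.tail (by omega))

lemma permutes_andCircuitInv (O : Access p q r) {a : ℕ → W} {K : ℕ} {ws : List W} {i : ℕ}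
    (h : Ancillas a K ws) (hi : i + ws.length ≤ K) :
    Permutes O (andCircuitInv a ws i) (andRun a ws i) := by
  induction ws generalizing i with
  | nil => exact permutes_nil O
  | cons w ws ih =>
    rw [List.length_cons] at hi
    exact (ih h.tail (by omega)).append (permutes_andStepCircuit O (h.distinct (by omega)))

lemma andUndo_andRun {a : ℕ → W} {K : ℕ} {ws : List W} {i : ℕ}
    (h : Ancillas a K ws) (hi : i + ws.length ≤ K) (x : Bits W) :
    andUndo a ws i (andRun a ws i x) = x := by
  induction ws generalizing i x with
  | nil => rfl
  | cons w ws ih =>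
    rw [List.length_cons] at hi
    obtain ⟨h1, h2, h3⟩ := h.distinct (i := i) (by omega)
    rw [andRun, andUndo, ih h.tail (by omega), andStep_andStep h2 h3]

lemma andRun_andUndo {a : ℕ → W} {K : ℕ} {ws : List W} {i : ℕ}
    (h : Ancillas a K ws) (hi : i + ws.length ≤ K) (x : Bits W) :
    andRun a ws i (andUndo a ws i x) = x := by
  induction ws generalizing i x with
  | nil => rfl
  | cons w ws ih =>
    rw [List.length_cons] at hi
    obtain ⟨h1, h2, h3⟩ := h.distinct (i := i) (by omega)
    rw [andRun, andUndo, andStep_andStep h2 h3, ih h.tail (by omega)]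

lemma andRun_of_ne {a : ℕ → W} {ws : List W} {i : ℕ} {v : W} (hv : ∀ j, v ≠ a j) (x : Bits W) :
    andRun a ws i x v = x v := by
  induction ws generalizing i x with
  | nil => rfl
  | cons w ws ih => rw [andRun, ih, andStep_of_ne (hv _)]

/-- The conjunction steps neither read nor write `f`, so a flag set between computing and
uncomputing survives. -/
lemma andUndo_update {a : ℕ → W} {ws : List W} {i : ℕ} {f : W} (hf : ∀ j, f ≠ a j)
    (hws : f ∉ ws) (x : Bits W) (t : Bool) :
    andUndo a ws i (Function.update x f t) = Function.update (andUndo a ws i x) f t := by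
  induction ws generalizing i with
  | nil => rfl
  | cons w ws ih =>
    simp only [List.mem_cons, not_or] at hws
    rw [andUndo, andUndo, ih hws.2, andStep_update (Ne.symm hws.1) (hf _).symm (hf _).symm]

/-- Each ancilla receives the conjunction of its predecessor with one more negated qubit. The later
ancillas must start at `0` because the Toffoli gate adds its result by XOR. -/
lemma andRun_last {a : ℕ → W} {K : ℕ} {ws : List W} {i : ℕ}
    (h : Ancillas a K ws) (hi : i + ws.length ≤ K) (x : Bits W)
    (hx : ∀ j, i < j → j ≤ K → x (a j) = false) :
    andRun a ws i x (a (i + ws.length)) = (x (a i) && ws.all fun w => !x w) := by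
  induction ws generalizing i x with
  | nil => simp [andRun]
  | cons w ws ih =>
    rw [List.length_cons] at hi ⊢
    rw [andRun, show i + (ws.length + 1) = i + 1 + ws.length by ring, ih h.tail (by omega)]
    · have h1 : andStep w (a i) (a (i + 1)) x (a (i + 1)) = (!x w && x (a i)) := by
        simp [andStep, hx (i + 1) (by omega) (by omega)]
      have h2 : (ws.all fun w' => !andStep w (a i) (a (i + 1)) x w') = ws.all fun w => !x w := by
        rw [Bool.eq_iff_iff, List.all_eq_true, List.all_eq_true]
        refine forall₂_congr fun v hv => ?_
        rw [andStep_of_ne (h.tail.ne v hv _)]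
      rw [h1, h2, List.all_cons]
      cases x w <;> cases x (a i) <;> rfl
    · intro j hj hjK
      rw [andStep_of_ne, hx j (by omega) hjK]
      intro h'
      have := h.inj _ _ hjK (by omega) h'
      omega

/-- Flip the first ancilla, then run `andRun`. -/
def conjRun (a : ℕ → W) (ws : List W) (x : Bits W) : Bits W :=
  andRun a ws 0 (Function.update x (a 0) (!x (a 0)))

/-- Undo `conjRun`. -/
def conjUndo (a : ℕ → W) (ws : List W) (x : Bits W) : Bits W :=
  Function.update (andUndo a ws 0 x) (a 0) (!andUndo a ws 0 x (a 0))

/-- The circuit that composes states with `conjUndo`. -/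
def conjCircuit (a : ℕ → W) (ws : List W) : List (Gate p q r W) :=
  [Gate.X (embOne (a 0))] ++ andCircuit a ws 0

/-- The circuit that composes states with `conjRun`. -/
def conjCircuitInv (a : ℕ → W) (ws : List W) : List (Gate p q r W) :=
  andCircuitInv a ws 0 ++ [Gate.X (embOne (a 0))]

/-- Flip the sign of the amplitudes of the labels that are zero on `ws`. -/
def reflectCircuit (a : ℕ → W) (ws : List W) : List (Gate p q r W) :=
  conjCircuit a ws ++ (signGate (a ws.length) ++ conjCircuitInv a ws)

/-- Flip the qubit `f` in the labels that are zero on `ws`. -/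
def flagCircuit (a : ℕ → W) (ws : List W) (f : W) : List (Gate p q r W) :=
  conjCircuit a ws ++ (cnot (a ws.length) f ++ conjCircuitInv a ws)

lemma gateTime_reflectCircuit_le (τ : ℝ) (a : ℕ → W) (ws : List W) :
    gateTime τ (reflectCircuit a ws : List (Gate p q r W)) ≤ 6 * ws.length + 6 := by
  have h1 := gateTime_andCircuit_le (p := p) (q := q) (r := r) τ a ws 0
  have h2 := gateTime_andCircuitInv_le (p := p) (q := q) (r := r) τ a ws 0
  simp only [reflectCircuit, conjCircuit, conjCircuitInv, signGate, gateTime_append,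
    gateTime_cons, gateTime_nil, Gate.time, List.replicate]
  linarith

lemma gateTime_flagCircuit_le (τ : ℝ) (a : ℕ → W) (ws : List W) (f : W) :
    gateTime τ (flagCircuit a ws f : List (Gate p q r W)) ≤ 6 * ws.length + 3 := by
  have h1 := gateTime_andCircuit_le (p := p) (q := q) (r := r) τ a ws 0
  have h2 := gateTime_andCircuitInv_le (p := p) (q := q) (r := r) τ a ws 0
  have h3 : gateTime τ (cnot (a ws.length) f : List (Gate p q r W)) ≤ 1 := by
    unfold cnot
    split_ifs <;> simp [Gate.time]
  simp only [flagCircuit, conjCircuit, conjCircuitInv, gateTime_append,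
    gateTime_cons, gateTime_nil, Gate.time]
  linarith

/-! ### Reflections and flags by computing and uncomputing a conjunction -/

variable {a : ℕ → W} {ws : List W}

lemma permutes_conjCircuit (O : Access p q r) (h : Ancillas a ws.length ws) :
    Permutes O (conjCircuit a ws) (conjUndo a ws) :=
  (permutes_X O (a 0)).append (permutes_andCircuit O h (by simp))

lemma permutes_conjCircuitInv (O : Access p q r) (h : Ancillas a ws.length ws) :
    Permutes O (conjCircuitInv a ws) (conjRun a ws) :=
  (permutes_andCircuitInv O h (by simp)).append (permutes_X O (a 0))

lemma conjUndo_conjRun (h : Ancillas a ws.length ws) (x : Bits W) :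
    conjUndo a ws (conjRun a ws x) = x := by
  simp [conjUndo, conjRun, andUndo_andRun h]

lemma conjRun_conjUndo (h : Ancillas a ws.length ws) (x : Bits W) :
    conjRun a ws (conjUndo a ws x) = x := by
  simp [conjUndo, conjRun, andRun_andUndo h]

/-- The initial flip of `a 0` supplies the empty conjunction, `true`. -/
lemma conjRun_last (h : Ancillas a ws.length ws) {x : Bits W} (hx : ∀ j, x (a j) = false) :
    conjRun a ws x (a ws.length) = ws.all fun w => !x w := by
  have := andRun_last (i := 0) h (by simp) (Function.update x (a 0) (!x (a 0))) ?_
  · rw [zero_add] at this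
    rw [conjRun, this]
    simp only [Function.update_self, hx, Bool.not_false, Bool.true_and]
    rw [Bool.eq_iff_iff, List.all_eq_true, List.all_eq_true]
    refine forall₂_congr fun v hv => ?_
    rw [Function.update_of_ne (h.ne v hv _)]
  · intro j hj hjK
    rw [Function.update_of_ne, hx]
    intro h'
    have := h.inj _ _ hjK (by omega) h'
    omega

/-- Compute, apply a phase, uncompute. The result is a diagonal matrix of signs even on dirty
ancillas, which makes the circuit its own inverse and adjoint. -/
lemma run_reflectCircuit (O : Access p q r) (h : Ancillas a ws.length ws) (ψ : State W)
    (x : Bits W) :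
    run O (reflectCircuit a ws) ψ x =
      (if conjRun a ws x (a ws.length) then -1 else 1) * ψ x := by
  rw [reflectCircuit, run_append, run_append, permutes_conjCircuitInv O h, Function.comp_apply,
    run_signGate, permutes_conjCircuit O h, Function.comp_apply, conjUndo_conjRun h]

lemma inversePair_reflectCircuit [Fintype W] (O : Access p q r) (h : Ancillas a ws.length ws) :
    InversePair O (reflectCircuit a ws) (reflectCircuit a ws) := by
  have h1 : ∀ ψ, run O (reflectCircuit a ws) (run O (reflectCircuit a ws) ψ) = ψ := by
    intro ψ
    funext x
    rw [run_reflectCircuit O h, run_reflectCircuit O h]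
    split_ifs <;> simp
  refine ⟨h1, h1, fun φ χ => ?_⟩
  refine Finset.sum_congr rfl fun x _ => ?_
  rw [run_reflectCircuit O h, run_reflectCircuit O h]
  split_ifs <;> simp

/-- On a state with clean ancillas, `reflectCircuit` is a reflection. -/
lemma run_reflectCircuit_of_clean (O : Access p q r) (h : Ancillas a ws.length ws) {ψ : State W}
    (hψ : Clean (Set.range a) ψ) (x : Bits W) :
    run O (reflectCircuit a ws) ψ x =
      ψ x - 2 * if ∀ w ∈ ws, x w = false then ψ x else 0 := by
  rw [run_reflectCircuit O h]
  by_cases hx : ∀ j, x (a j) = false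
  · rw [conjRun_last h hx]
    by_cases hw : ∀ w ∈ ws, x w = false
    · rw [if_pos (by simpa using hw), if_pos hw]
      ring
    · rw [if_neg (by simpa using hw), if_neg hw]
      ring
  · have : ψ x = 0 := by
      push Not at hx
      obtain ⟨j, hj⟩ := hx
      exact hψ x ⟨a j, ⟨j, rfl⟩, by simpa using hj⟩
    simp [this]

open Classical in
/-- On a state with clean ancillas and flag, `flagCircuit` computes the conjunction into the
flag. -/
lemma run_flagCircuit_of_clean (O : Access p q r) (h : Ancillas a ws.length ws) {f : W}
    (hf : ∀ j, f ≠ a j) (hfw : f ∉ ws) {ψ : State W} (hψ : Clean (insert f (Set.range a)) ψ)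
    {x : Bits W} (hx : x f = true) :
    run O (flagCircuit a ws f) ψ x =
      if (∀ j, x (a j) = false) ∧ ∀ w ∈ ws, x w = false
      then ψ (Function.update x f false) else 0 := by
  have hperm := (permutes_conjCircuit O h).append
    ((permutes_cnot O (hf ws.length).symm).append (permutes_conjCircuitInv O h))
  set g : Bits W → Bits W :=
    fun x => Function.update x f (x f ^^ x (a ws.length)) with hg
  -- The whole circuit is the pullback along one involution `ρ`.
  set ρ := conjUndo a ws ∘ g ∘ conjRun a ws with hρ
  have hgg : ∀ x, g (g x) = x := by
    intro x
    simp [hg, (hf ws.length).symm]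
  have hinv : ∀ x, ρ (ρ x) = x := by
    intro x
    simp only [hρ, Function.comp_apply, conjRun_conjUndo h, hgg, conjUndo_conjRun h]
  -- On labels with clean ancillas and flag, `ρ` only writes the conjunction into the flag.
  have hclean : ∀ y : Bits W, (∀ j, y (a j) = false) → y f = false →
      ρ y = Function.update y f (ws.all fun w => !y w) := by
    intro y hy hyf
    have h1 : conjRun a ws y f = false := by
      rw [conjRun, andRun_of_ne hf, Function.update_of_ne (hf 0), hyf]
    simp only [hρ, hg, Function.comp_apply, h1, conjRun_last h hy, Bool.false_xor]
    have h2 : ∀ z t, conjUndo a ws (Function.update z f t) =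
        Function.update (conjUndo a ws z) f t := by
      intro z t
      simp only [conjUndo, andUndo_update hf hfw, Function.update_of_ne (hf 0).symm]
      rw [Function.update_comm (hf 0)]
    rw [h2, conjUndo_conjRun h]
  rw [flagCircuit, hperm ψ]
  change ψ (ρ x) = _
  split_ifs with hc
  · obtain ⟨hxa, hxw⟩ := hc
    congr 1
    -- Lowering the flag of `x` gives a clean label that `ρ` sends to `x`, hence `ρ x = y`.
    set y := Function.update x f false with hy
    have : ρ y = x := by
      rw [hclean y (fun j => by rw [hy, Function.update_of_ne (hf j).symm, hxa j]) (by simp [hy])]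
      have : (ws.all fun w => !y w) = true := by
        rw [List.all_eq_true]
        intro w hw
        have hwf : w ≠ f := fun h' => hfw (h' ▸ hw)
        simp [hy, hwf, hxw w hw]
      rw [this, hy, Function.update_idem, ← hx, Function.update_eq_self]
    rw [← this, hinv]
  -- If `ρ x` were clean, then `x = ρ (ρ x)` would differ from it only in the flag, and the raised
  -- flag would force the excluded condition on `x`. So `ρ x` is not clean, and `ψ` vanishes there.
  · by_cases hy : (∀ j, ρ x (a j) = false) ∧ ρ x f = false
    · exfalso
      have h1 := hclean _ hy.1 hy.2
      rw [hinv] at h1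
      have h2 : (ws.all fun w => !ρ x w) = true := by
        have := congrFun h1 f
        rwa [hx, Function.update_self, eq_comm] at this
      have h3 : ∀ v, v ≠ f → x v = ρ x v := by
        intro v hv
        conv_lhs => rw [h1]
        rw [Function.update_of_ne hv]
      refine hc ⟨fun j => by rw [h3 _ (hf j).symm, hy.1], fun w hw => ?_⟩
      rw [h3 w fun h' => hfw (h' ▸ hw)]
      simpa using List.all_eq_true.1 h2 w hw
    · refine hψ _ ?_
      rw [not_and_or] at hy
      rcases hy with hy | hy
      · push Not at hy
        obtain ⟨j, hj⟩ := hy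
        exact ⟨a j, Or.inr ⟨j, rfl⟩, by simpa using hj⟩
      · exact ⟨f, Or.inl rfl, by simpa using hy⟩

end Conjunction

/-! ### Norms of encoded matrices -/

lemma enc_injective {n b : ℕ} (h : n ≤ 2 ^ b) : Function.Injective (enc b : Fin n → Bits (Fin b)) := by
  intro i j hij
  apply Fin.ext
  apply Nat.eq_of_testBit_eq
  intro k
  by_cases hk : k < b
  · exact congrFun hij ⟨k, hk⟩
  · have h2 : 2 ^ b ≤ 2 ^ k := Nat.pow_le_pow_right (by norm_num) (by omega)
    rw [Nat.testBit_lt_two_pow (i.2.trans_le (h.trans h2)),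
      Nat.testBit_lt_two_pow (j.2.trans_le (h.trans h2))]

lemma frobenius_norm_sq {m n : ℕ} (M : Matrix (Fin m) (Fin n) ℝ) :
    ‖M‖ ^ 2 = ∑ i, ∑ j, M i j ^ 2 := by
  have h0 : 0 ≤ ∑ i, ∑ j, M i j ^ 2 :=
    Finset.sum_nonneg fun i _ => Finset.sum_nonneg fun j _ => sq_nonneg _
  rw [Matrix.frobenius_norm_def, ← Real.sqrt_eq_rpow, Real.sq_sqrt]
  · simp
  · simpa using h0

/-- By injectivity of the encoding each matrix entry occupies its own label, and all other labels
carry amplitude zero. -/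
lemma sum_norm_ketMat_sq {m n b c : ℕ} (hm : m ≤ 2 ^ b) (hn : n ≤ 2 ^ c)
    (M : Matrix (Fin m) (Fin n) ℝ) :
    ∑ u, ∑ v, ‖ketMat b c M u v‖ ^ 2 = ‖M‖ ^ 2 := by
  rw [frobenius_norm_sq, ← Fintype.sum_prod_type', ← Fintype.sum_prod_type']
  symm
  refine Finset.sum_of_injOn (fun z => (enc b z.1, enc c z.2)) ?_ (by simp) ?_ ?_
  · rintro ⟨i, j⟩ _ ⟨i', j'⟩ _ h
    simp only [Prod.mk.injEq] at h ⊢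
    exact ⟨enc_injective hm h.1, enc_injective hn h.2⟩
  · rintro ⟨u, v⟩ _ h
    have : ketMat b c M u v = 0 := by
      refine Finset.sum_eq_zero fun i _ => Finset.sum_eq_zero fun j _ => if_neg ?_
      rintro ⟨rfl, rfl⟩
      exact h ⟨(i, j), by simp, rfl⟩
    simp [this]
  · rintro ⟨i, j⟩ _
    have : ketMat b c M (enc b i) (enc c j) = M i j := by
      simp only [ketMat, (enc_injective hm).eq_iff, (enc_injective hn).eq_iff]
      rw [Finset.sum_eq_single i (by intro k _ hk; simp [hk]) (by simp),
        Finset.sum_eq_single j (by intro k _ hk; simp [hk]) (by simp)]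
      simp
    simp [this]

/-! ### Basis labels of the qubits of a round -/

section Labels

variable {p q r s : ℕ}

/-- The basis label with registers `u`, `v`, `w` and further qubits `t`. -/
def label (u : Bits (Fin p)) (v : Bits (Fin r)) (w : Bits (Fin q)) (t : Bits (Unit ⊕ Fin s)) :
    Bits (Wires p q r s) :=
  Sum.elim u (Sum.elim v (Sum.elim w t))

lemma exists_eq_label (x : Bits (Wires p q r s)) : ∃ u v w t, x = label u v w t := by
  refine ⟨fun i => x (.inl i), fun i => x (.inr (.inl i)), fun i => x (.inr (.inr (.inl i))),
    fun i => x (.inr (.inr (.inr i))), ?_⟩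
  funext i
  rcases i with i | i | i | i <;> rfl

lemma label_inj {u u' : Bits (Fin p)} {v v' : Bits (Fin r)} {w w' : Bits (Fin q)}
    {t t' : Bits (Unit ⊕ Fin s)} :
    label u v w t = label u' v' w' t' ↔ u = u' ∧ v = v' ∧ w = w' ∧ t = t' := by
  simp only [label, Sum.elim_eq_iff]

lemma zeros_eq_label : zeros (Wires p q r s) = label (zeros _) (zeros _) (zeros _) (zeros _) := by
  funext i
  rcases i with i | i | i | i <;> rfl

/-- The registers that hold row and column indices of `A`. -/
def embPQ : Fin p ⊕ Fin q ↪ Wires p q r s :=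
  ⟨Sum.elim Sum.inl fun i => Sum.inr (Sum.inr (Sum.inl i)), by
    rintro (i | i) (j | j) h <;> simp_all⟩

/-- The registers that hold row and column indices of `B`. -/
def embQR : Fin q ⊕ Fin r ↪ Wires p q r s :=
  ⟨Sum.elim (fun i => Sum.inr (Sum.inr (Sum.inl i))) fun i => Sum.inr (Sum.inl i), by
    rintro (i | i) (j | j) h <;> simp_all⟩

lemma label_comp_embPQ (u : Bits (Fin p)) (v : Bits (Fin r)) (w : Bits (Fin q))
    (t : Bits (Unit ⊕ Fin s)) : label u v w t ∘ embPQ = Sum.elim u w := by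
  funext i
  rcases i with i | i <;> rfl

lemma label_comp_embQR (u : Bits (Fin p)) (v : Bits (Fin r)) (w : Bits (Fin q))
    (t : Bits (Unit ⊕ Fin s)) : label u v w t ∘ embQR = Sum.elim w v := by
  funext i
  rcases i with i | i <;> rfl

lemma extend_embPQ (u u' : Bits (Fin p)) (v : Bits (Fin r)) (w w' : Bits (Fin q))
    (t : Bits (Unit ⊕ Fin s)) :
    Function.extend embPQ (Sum.elim u' w') (label u v w t) = label u' v w' t := by
  funext i
  rcases i with i | i | i | i
  · exact extend_apply_of_eq embPQ (Sum.elim u' w') _ (i := Sum.inl i) rfl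
  · exact Function.extend_apply' _ _ _ (by rintro ⟨j | j, hj⟩ <;> simp [embPQ, DFunLike.coe] at hj)
  · exact extend_apply_of_eq embPQ (Sum.elim u' w') _ (i := Sum.inr i) rfl
  · exact Function.extend_apply' _ _ _ (by rintro ⟨j | j, hj⟩ <;> simp [embPQ, DFunLike.coe] at hj)

lemma extend_embQR (u : Bits (Fin p)) (v v' : Bits (Fin r)) (w w' : Bits (Fin q))
    (t : Bits (Unit ⊕ Fin s)) :
    Function.extend embQR (Sum.elim w' v') (label u v w t) = label u v' w' t := by
  funext i
  rcases i with i | i | i | i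
  · exact Function.extend_apply' _ _ _ (by rintro ⟨j | j, hj⟩ <;> simp [embQR, DFunLike.coe] at hj)
  · exact extend_apply_of_eq embQR (Sum.elim w' v') _ (i := Sum.inr i) rfl
  · exact extend_apply_of_eq embQR (Sum.elim w' v') _ (i := Sum.inl i) rfl
  · exact Function.extend_apply' _ _ _ (by rintro ⟨j | j, hj⟩ <;> simp [embQR, DFunLike.coe] at hj)

lemma sum_bits_sum {α β : Type} [Fintype α] [Fintype β] [DecidableEq α] [DecidableEq β]
    (f : Bits (α ⊕ β) → ℂ) :
    ∑ y, f y = ∑ a : Bits α, ∑ b : Bits β, f (Sum.elim a b) := by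
  rw [← Fintype.sum_prod_type' fun (a : Bits α) (b : Bits β) => f (Sum.elim a b)]
  exact ((Equiv.sumArrowEquivProdArrow α β Bool).symm.sum_comp f).symm

lemma applyOn_embPQ (U : Matrix (Bits (Fin p ⊕ Fin q)) (Bits (Fin p ⊕ Fin q)) ℂ)
    (ψ : State (Wires p q r s)) (u : Bits (Fin p)) (v : Bits (Fin r)) (w : Bits (Fin q))
    (t : Bits (Unit ⊕ Fin s)) :
    applyOn embPQ U ψ (label u v w t) =
      ∑ u', ∑ w', U (Sum.elim u w) (Sum.elim u' w') * ψ (label u' v w' t) := by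
  simp only [applyOn, label_comp_embPQ, sum_bits_sum, extend_embPQ]

lemma applyOn_embQR (U : Matrix (Bits (Fin q ⊕ Fin r)) (Bits (Fin q ⊕ Fin r)) ℂ)
    (ψ : State (Wires p q r s)) (u : Bits (Fin p)) (v : Bits (Fin r)) (w : Bits (Fin q))
    (t : Bits (Unit ⊕ Fin s)) :
    applyOn embQR U ψ (label u v w t) =
      ∑ w', ∑ v', U (Sum.elim w v) (Sum.elim w' v') * ψ (label u v' w' t) := by
  simp only [applyOn, label_comp_embQR, sum_bits_sum, extend_embQR]

/-- The state of the qubits after the registers when only the flag may be nonzero. -/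
def flagBits (s : ℕ) (b : Bool) : Bits (Unit ⊕ Fin s) := Sum.elim (fun _ => b) (zeros _)

lemma flagBits_false : flagBits s false = zeros _ := by
  funext i
  rcases i with i | i <;> rfl

/-- The state `|M⟩` in the output registers, with flag `b` and all other qubits in `|0⟩`. -/
def productState {l n : ℕ} (p q r s : ℕ) (b : Bool) (M : Matrix (Fin l) (Fin n) ℝ) :
    State (Wires p q r s) :=
  fun x =>
    if (∀ t, x (Sum.inr (Sum.inr (Sum.inl t))) = false) ∧ x flag = b ∧
        ∀ t, x (Sum.inr (Sum.inr (Sum.inr (Sum.inr t)))) = false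
    then ketMat p r M (fun t => x (Sum.inl t)) (fun t => x (Sum.inr (Sum.inl t))) / (‖M‖ : ℂ)
    else 0

lemma targetState_eq {l n : ℕ} (M : Matrix (Fin l) (Fin n) ℝ) :
    targetState p q r s M = productState p q r s true M := rfl

lemma productState_label {l n : ℕ} (b : Bool) (M : Matrix (Fin l) (Fin n) ℝ)
    (u : Bits (Fin p)) (v : Bits (Fin r)) (w : Bits (Fin q)) (t : Bits (Unit ⊕ Fin s)) :
    productState p q r s b M (label u v w t) =
      if w = zeros _ ∧ t = flagBits s b then ketMat p r M u v / (‖M‖ : ℂ) else 0 := by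
  unfold productState
  refine if_congr ?_ rfl rfl
  refine and_congr ⟨fun h => funext h, fun h => congrFun h⟩ ?_
  constructor
  · rintro ⟨h1, h2⟩
    funext i
    rcases i with i | i
    exacts [h1, h2 i]
  · rintro rfl
    exact ⟨rfl, fun _ => rfl⟩

lemma sum_norm_productState_sq {l n : ℕ} (hl : l ≤ 2 ^ p) (hn : n ≤ 2 ^ r) (b : Bool)
    {M : Matrix (Fin l) (Fin n) ℝ} (hM : M ≠ 0) :
    ∑ x, ‖productState p q r s b M x‖ ^ 2 = 1 := by
  have h0 : ‖M‖ ^ 2 ≠ 0 := pow_ne_zero _ (norm_ne_zero_iff.2 hM)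
  rw [← div_self h0]
  conv_rhs => rw [← sum_norm_ketMat_sq hl hn, Finset.sum_div]
  simp only [Finset.sum_div]
  rw [← Fintype.sum_prod_type']
  symm
  refine Finset.sum_of_injOn (fun z => label z.1 z.2 (zeros _) (flagBits s b)) ?_ (by simp) ?_ ?_
  · rintro ⟨u, v⟩ _ ⟨u', v'⟩ _ h
    simp only [label_inj] at h
    simp [h.1, h.2.1]
  · intro x _ h
    obtain ⟨u, v, w, t, rfl⟩ := exists_eq_label x
    rw [productState_label, if_neg, norm_zero]
    · simp
    · rintro ⟨rfl, rfl⟩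
      exact h ⟨(u, v), by simp, rfl⟩
  · rintro ⟨u, v⟩ _
    simp [productState_label, div_pow, sum_norm_ketMat_sq hl hn]

end Labels

/-! ### Preparation of a state with a component along the product -/

section Prep

variable {p q r s l m n : ℕ}

/-- The circuit that prepares a state whose component with a zero middle register is
proportional to `|AB⟩`. -/
def prep (p q r s : ℕ) : List (Gate p q r (Wires p q r s)) :=
  [.matPrep embQR, .normPrep embPQ, .rowPrepInv embPQ]

/-- The inverse of `prep`. -/
def prepInv (p q r s : ℕ) : List (Gate p q r (Wires p q r s)) :=
  [.rowPrep embPQ, .normPrepInv embPQ, .matPrepInv embQR]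

lemma inversePair_prep (O : Access p q r) : InversePair O (prep p q r s) (prepInv p q r s) := by
  have h1 : InversePair O [Gate.matPrep (embQR (p := p) (s := s))] [.matPrepInv embQR] :=
    inversePair_of_unitary embQR O.matPrep.2 rfl rfl
  have h2 : InversePair O [Gate.normPrep (embPQ (r := r) (s := s))] [.normPrepInv embPQ] :=
    inversePair_of_unitary embPQ O.normPrep.2 rfl rfl
  have h3 : InversePair O [Gate.rowPrepInv (embPQ (r := r) (s := s))] [.rowPrep embPQ] :=
    inversePair_of_unitary embPQ (Unitary.star_mem O.rowPrep.2) rfl (by rw [star_star]; rfl)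
  exact h1.append (h2.append h3)

/-- Pairing the middle registers contracts the index `j`; this is where the matrix product arises.
-/
lemma sum_ketVec_mul_ketMat (hm : m ≤ 2 ^ q) (a : Fin m → ℝ) (B : Matrix (Fin m) (Fin n) ℝ)
    (v : Bits (Fin r)) :
    ∑ w, ketVec q a w * ketMat q r B w v =
      ∑ k, if enc r k = v then ((∑ j, a j * B j k : ℝ) : ℂ) else 0 := by
  have h1 : ∀ w, ketVec q a w * ketMat q r B w v =
      ∑ j, if enc q j = w then (a j : ℂ) * ∑ k, if enc r k = v then (B j k : ℂ) else 0
        else 0 := by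
    intro w
    rw [ketVec, Finset.sum_mul]
    refine Finset.sum_congr rfl fun j _ => ?_
    split_ifs with hj
    · subst hj
      congr 1
      simp only [ketMat, (enc_injective hm).eq_iff]
      rw [Finset.sum_eq_single j (by intro k _ hk; simp [hk]) (by simp)]
      simp
    · simp
  simp only [h1]
  rw [Finset.sum_comm]
  simp only [Finset.sum_ite_eq, Finset.mem_univ, if_true, Finset.mul_sum]
  rw [Finset.sum_comm]
  refine Finset.sum_congr rfl fun k _ => ?_
  split_ifs <;> simp

lemma run_prep_label {O : Access p q r} {A : Matrix (Fin l) (Fin m) ℝ}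
    {B : Matrix (Fin m) (Fin n) ℝ} (hO : O.Encodes A B) (hm : m ≤ 2 ^ q)
    (u : Bits (Fin p)) (v : Bits (Fin r)) (t : Bits (Unit ⊕ Fin s)) :
    run O (prep p q r s) (ketZero _) (label u v (zeros _) t) =
      if t = zeros _ then ketMat p r (A * B) u v / ((‖A‖ : ℂ) * ‖B‖) else 0 := by
  have h1 : ∀ u v w t, applyOn embQR (O.matPrep : Matrix _ _ ℂ)
      (ketZero (Wires p q r s)) (label u v w t) =
        if u = zeros _ ∧ t = zeros _ then ketMat q r B w v / (‖B‖ : ℂ) else 0 := by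
    intro u v w t
    rw [applyOn_embQR, Finset.sum_eq_single (zeros _), Finset.sum_eq_single (zeros _)]
    · rw [hO.matrix, ketZero, zeros_eq_label]
      simp [label_inj]
    · intro v' _ hv'
      simp [ketZero, zeros_eq_label, label_inj, hv']
    · simp
    · intro w' _ hw'
      simp [ketZero, zeros_eq_label, label_inj, hw']
    · simp
  have h2 : ∀ u v w t, applyOn embPQ (O.normPrep : Matrix _ _ ℂ)
      (applyOn embQR (O.matPrep : Matrix _ _ ℂ) (ketZero (Wires p q r s))) (label u v w t) =
        if t = zeros _ then ketVec p (rowNorm A) u / (‖A‖ : ℂ) * (ketMat q r B w v / (‖B‖ : ℂ))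
        else 0 := by
    intro u v w t
    rw [applyOn_embPQ, Finset.sum_eq_single (zeros _)]
    · simp only [hO.norms _ _ _, h1]
      simp
    · intro u' _ hu'
      simp [h1, hu']
    · simp
  simp only [prep, run_cons, run_nil, Gate.act]
  -- The amplitude of the inverse row preparation at `(u, 0)` is the overlap with `|u⟩|φ⟩`.
  obtain ⟨φ, hφ, hφA⟩ := hO.rows u
  rw [applyOn_embPQ]
  simp only [Matrix.star_apply, hφ, h2]
  rw [Finset.sum_eq_single u (by intro u' _ hu'; simp [hu']) (by simp)]
  simp only [if_true]
  split_ifs with ht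
  -- The norm amplitude restores the unnormalized row. It vanishes at zero rows and at labels of no
  -- row, so the arbitrary `φ` there is harmless. Conjugation has no effect because `A` is real.
  · have h3 : ∀ w, ketVec p (rowNorm A) u * star (φ w) =
        ∑ i, if enc p i = u then ketVec q (A i) w else 0 := by
      intro w
      rw [ketVec, Finset.sum_mul]
      refine Finset.sum_congr rfl fun i _ => ?_
      split_ifs with hi
      · have := congrArg star (hφA i hi w)
        rw [star_mul'] at this
        simp only [RCLike.star_def, Complex.conj_ofReal] at this ⊢
        rw [this]
        simp [ketVec, apply_ite (starRingEnd ℂ)]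
      · simp
    have h4 : ∑ w, ketVec p (rowNorm A) u * star (φ w) * ketMat q r B w v =
        ketMat p r (A * B) u v := by
      simp only [h3, Finset.sum_mul]
      rw [Finset.sum_comm, ketMat]
      refine Finset.sum_congr rfl fun i _ => ?_
      by_cases hi : enc p i = u
      · simp only [hi, if_true, sum_ketVec_mul_ketMat hm, true_and, Matrix.mul_apply]
      · simp [hi]
    rw [← h4, Finset.sum_div]
    refine Finset.sum_congr rfl fun w _ => ?_
    rw [div_mul_div_comm]
    ring
  · simp

end Prep

/-! ### Amplitude amplification -/

section Amplification

/-- The number of ancillas that suffices for conjunctions over the registers. -/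
abbrev ancillaCount (p q r : ℕ) : ℕ := p + q + r + 1

variable {p q r : ℕ}

/-- The ancillas as a sequence of qubits. -/
def anc (i : ℕ) : Wires p q r (ancillaCount p q r) :=
  Sum.inr (Sum.inr (Sum.inr (Sum.inr (Fin.ofNat (ancillaCount p q r) i))))

/-- The qubits of the registers. -/
def registerQubits (p q r : ℕ) : List (Wires p q r (ancillaCount p q r)) :=
  (Finset.univ : Finset (Fin p ⊕ Fin r ⊕ Fin q)).toList.map
    (Sum.map id (Sum.map id Sum.inl))

/-- The qubits of the middle register. -/
def middleQubits (p q r : ℕ) : List (Wires p q r (ancillaCount p q r)) :=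
  (List.finRange q).map fun i => Sum.inr (Sum.inr (Sum.inl i))

/-- `anc` wraps around, so it is injective only up to index `p + q + r`. That is just enough for a
conjunction over all registers. -/
lemma anc_inj {i j : ℕ} (hi : i ≤ p + q + r) (hj : j ≤ p + q + r)
    (h : (anc i : Wires p q r _) = anc j) : i = j := by
  simp only [anc, Sum.inr.injEq, Fin.ext_iff, Fin.val_ofNat] at h
  rwa [Nat.mod_eq_of_lt (Nat.lt_succ_of_le hi), Nat.mod_eq_of_lt (Nat.lt_succ_of_le hj)] at h

lemma exists_anc (t : Fin (ancillaCount p q r)) :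
    (Sum.inr (Sum.inr (Sum.inr (Sum.inr t))) : Wires p q r _) = anc t := by
  simp [anc]

lemma length_registerQubits : (registerQubits p q r).length = p + q + r := by
  simp [registerQubits]
  ring

lemma length_middleQubits : (middleQubits p q r).length = q := by
  simp [middleQubits]

lemma ancillas_registerQubits :
    Ancillas anc (registerQubits p q r).length (registerQubits p q r) where
  inj i j hi hj h := by
    rw [length_registerQubits] at hi hj
    exact anc_inj hi hj h
  ne w hw j := by
    simp only [registerQubits, List.mem_map] at hw
    obtain ⟨i | i | i, -, rfl⟩ := hw <;> simp [anc]

lemma ancillas_middleQubits :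
    Ancillas anc (middleQubits p q r).length (middleQubits p q r) where
  inj i j hi hj h := by
    rw [length_middleQubits] at hi hj
    exact anc_inj (by omega) (by omega) h
  ne w hw j := by
    simp only [middleQubits, List.mem_map] at hw
    obtain ⟨i, -, rfl⟩ := hw
    simp [anc]

lemma flag_ne_anc (j : ℕ) : (flag : Wires p q r (ancillaCount p q r)) ≠ anc j := by
  simp [flag, anc]

lemma flag_notMem_middleQubits : flag ∉ middleQubits p q r := by
  simp [flag, middleQubits]

lemma forall_middleQubits (x : Bits (Wires p q r (ancillaCount p q r))) :
    (∀ w ∈ middleQubits p q r, x w = false) ↔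
      ∀ t, x (Sum.inr (Sum.inr (Sum.inl t))) = false := by
  simp [middleQubits]

lemma forall_anc (x : Bits (Wires p q r (ancillaCount p q r))) :
    (∀ j, x (anc j) = false) ↔ ∀ t, x (Sum.inr (Sum.inr (Sum.inr (Sum.inr t)))) = false := by
  constructor
  · intro h t
    rw [exists_anc, h]
  · intro h j
    exact h _

/-- The qubits that stay in `|0⟩` during the amplification. -/
def idle (p q r : ℕ) : Set (Wires p q r (ancillaCount p q r)) := insert flag (Set.range anc)

/-- This makes the reflection in zero registers equal to `1 - 2|0⟩⟨0|` on clean states. -/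
lemma eq_zeros_of_registerQubits {x : Bits (Wires p q r (ancillaCount p q r))}
    (hx : ∀ v ∈ idle p q r, x v = false) (h : ∀ w ∈ registerQubits p q r, x w = false) :
    x = zeros _ := by
  funext v
  rcases v with i | i | i | i | i
  · exact h _ (List.mem_map.2 ⟨Sum.inl i, by simp, rfl⟩)
  · exact h _ (List.mem_map.2 ⟨Sum.inr (Sum.inl i), by simp, rfl⟩)
  · exact h _ (List.mem_map.2 ⟨Sum.inr (Sum.inr i), by simp, rfl⟩)
  · exact hx _ (Or.inl rfl)
  · rw [exists_anc]
    exact hx _ (Or.inr ⟨_, rfl⟩)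

/-- The reflection about the basis labels with zero middle register. -/
def reflectMiddle (p q r : ℕ) : List (Gate p q r (Wires p q r (ancillaCount p q r))) :=
  reflectCircuit anc (middleQubits p q r)

/-- The reflection about the basis labels with zero registers. -/
def reflectZero (p q r : ℕ) : List (Gate p q r (Wires p q r (ancillaCount p q r))) :=
  reflectCircuit anc (registerQubits p q r)

/-- The circuits of the iterated amplification, with their inverses. -/
def amplify (p q r : ℕ) : ℕ → List (Gate p q r (Wires p q r (ancillaCount p q r))) ×
    List (Gate p q r (Wires p q r (ancillaCount p q r)))
  | 0 => (prep p q r _, prepInv p q r _)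
  | e + 1 =>
    let c := amplify p q r e
    (c.1 ++ (reflectMiddle p q r ++ (c.2 ++ (reflectZero p q r ++ c.1))),
      (((c.2 ++ reflectZero p q r) ++ c.1) ++ reflectMiddle p q r) ++ c.2)

lemma InversePair.symm {W : Type} [Fintype W] [DecidableEq W] {O : Access p q r}
    {c d : List (Gate p q r W)} (h : InversePair O c d) : InversePair O d c where
  left := h.right
  right := h.left
  adjoint φ χ := by rw [← h.left χ, ← h.adjoint, h.right, h.left]

lemma inversePair_amplify (O : Access p q r) (e : ℕ) :
    InversePair O (amplify p q r e).1 (amplify p q r e).2 := by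
  induction e with
  | zero => exact inversePair_prep O
  | succ e ih =>
    exact ih.append ((inversePair_reflectCircuit O ancillas_middleQubits).append
      (ih.symm.append ((inversePair_reflectCircuit O ancillas_registerQubits).append ih)))

lemma clean_run_reflectCircuit {W : Type} [DecidableEq W] (O : Access p q r) {a : ℕ → W}
    {ws : List W} (h : Ancillas a ws.length ws) {N : Set W} {ψ : State W} (hψ : Clean N ψ) :
    Clean N (run O (reflectCircuit a ws) ψ) := by
  intro x hx
  rw [run_reflectCircuit O h, hψ x hx, mul_zero]

lemma embPQ_notMem_idle (i : Fin p ⊕ Fin q) : embPQ i ∉ idle p q r := by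
  rcases i with i | i <;> simp [idle, embPQ, flag, anc, DFunLike.coe]

lemma embQR_notMem_idle (i : Fin q ⊕ Fin r) : embQR i ∉ idle p q r := by
  rcases i with i | i <;> simp [idle, embQR, flag, anc, DFunLike.coe]

/-- Both directions go through one induction because each amplification step uses the inverse
circuit. -/
lemma clean_run_amplify (O : Access p q r) (e : ℕ) :
    ∀ ψ, Clean (idle p q r) ψ → Clean (idle p q r) (run O (amplify p q r e).1 ψ) ∧
      Clean (idle p q r) (run O (amplify p q r e).2 ψ) := by
  induction e with
  | zero =>
    intro ψ h
    exact ⟨((h.applyOn _ _ embQR_notMem_idle).applyOn _ _ embPQ_notMem_idle).applyOn _ _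
      embPQ_notMem_idle, ((h.applyOn _ _ embPQ_notMem_idle).applyOn _ _
      embPQ_notMem_idle).applyOn _ _ embQR_notMem_idle⟩
  | succ e ih =>
    intro ψ h
    have h1 : ∀ ψ, Clean (idle p q r) ψ → Clean (idle p q r) (run O (reflectMiddle p q r) ψ) :=
      fun ψ h => clean_run_reflectCircuit O ancillas_middleQubits h
    have h2 : ∀ ψ, Clean (idle p q r) ψ → Clean (idle p q r) (run O (reflectZero p q r) ψ) :=
      fun ψ h => clean_run_reflectCircuit O ancillas_registerQubits h
    simp only [amplify, run_append]
    exact ⟨(ih _ (h2 _ (ih _ (h1 _ (ih _ h).1)).2)).1, (ih _ (h1 _ (ih _ (h2 _ (ih _ h).2)).1)).2⟩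

lemma Clean.mono {W : Type} {N N' : Set W} {ψ : State W} (h : Clean N ψ) (hN : N' ⊆ N) :
    Clean N' ψ :=
  fun x ⟨v, hv, hx⟩ => h x ⟨v, hN hv, hx⟩

/-- The component with zero middle register. -/
def middleZero (ψ : State (Wires p q r (ancillaCount p q r))) :
    State (Wires p q r (ancillaCount p q r)) :=
  fun x => if ∀ w ∈ middleQubits p q r, x w = false then ψ x else 0

lemma middleZero_sub (φ ψ : State (Wires p q r (ancillaCount p q r))) :
    middleZero (φ - ψ) = middleZero φ - middleZero ψ := by
  funext x
  simp only [middleZero, Pi.sub_apply]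
  split_ifs <;> simp

lemma middleZero_smul (c : ℂ) (ψ : State (Wires p q r (ancillaCount p q r))) :
    middleZero (c • ψ) = c • middleZero ψ := by
  funext x
  simp only [middleZero, Pi.smul_apply]
  split_ifs <;> simp

lemma middleZero_middleZero (ψ : State (Wires p q r (ancillaCount p q r))) :
    middleZero (middleZero ψ) = middleZero ψ := by
  funext x
  simp only [middleZero]
  split_ifs <;> simp

lemma ip_middleZero (ψ : State (Wires p q r (ancillaCount p q r))) :
    ip ψ (middleZero ψ) = ip (middleZero ψ) (middleZero ψ) := by
  refine Finset.sum_congr rfl fun x _ => ?_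
  simp only [middleZero]
  split_ifs <;> simp

lemma run_reflectMiddle (O : Access p q r) {ψ : State (Wires p q r (ancillaCount p q r))}
    (h : Clean (idle p q r) ψ) :
    run O (reflectMiddle p q r) ψ = ψ - (2 : ℂ) • middleZero ψ := by
  funext x
  rw [reflectMiddle, run_reflectCircuit_of_clean O ancillas_middleQubits
    (h.mono (Set.subset_insert _ _))]
  rfl

lemma run_reflectZero (O : Access p q r) {ψ : State (Wires p q r (ancillaCount p q r))}
    (h : Clean (idle p q r) ψ) :
    run O (reflectZero p q r) ψ = ψ - (2 * ψ (zeros _)) • ketZero _ := by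
  funext x
  rw [reflectZero, run_reflectCircuit_of_clean O ancillas_registerQubits
    (h.mono (Set.subset_insert _ _))]
  simp only [Pi.sub_apply, Pi.smul_apply, ketZero, smul_eq_mul, mul_assoc]
  congr 2
  by_cases hx : x = zeros _
  · subst hx
    simp [zeros]
  · rw [if_neg hx, mul_zero]
    split_ifs with hr
    · refine h x ?_
      by_contra! hN
      exact hx (eq_zeros_of_registerQubits (fun v hv => by simpa using hN v hv) hr)
    · rfl

/-- The state after the amplification circuit. -/
def amplified (O : Access p q r) (e : ℕ) : State (Wires p q r (ancillaCount p q r)) :=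
  run O (amplify p q r e).1 (ketZero _)

lemma clean_amplified (O : Access p q r) (e : ℕ) : Clean (idle p q r) (amplified O e) :=
  (clean_run_amplify O e _ (clean_ketZero _)).1

lemma ip_amplified_self (O : Access p q r) (e : ℕ) : ip (amplified O e) (amplified O e) = 1 := by
  rw [amplified, (inversePair_amplify O e).adjoint, (inversePair_amplify O e).left,
    ip_ketZero_left]
  simp [ketZero]

/-- Let `P` be the projection `middleZero` and `ρ = ⟨ψ|Pψ⟩ = ‖Pψ‖²`. Conjugated by the circuit, the
reflection in `|0⟩` becomes `1 - 2|ψ⟩⟨ψ|`. Applied to `ψ - 2Pψ` it gives `ψ - 2Pψ - 2(1 - 2ρ)ψ`,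
whose projection is `-(3 - 4ρ)Pψ`. -/
lemma middleZero_amplified_succ (O : Access p q r) (e : ℕ) :
    middleZero (amplified O (e + 1)) =
      -(3 - 4 * ip (middleZero (amplified O e)) (middleZero (amplified O e))) •
        middleZero (amplified O e) := by
  have hclean := clean_amplified O e
  have hinv := inversePair_amplify O e
  set ψ := amplified O e with hψ
  have h1 : amplified O (e + 1) = run O (amplify p q r e).1 (run O (reflectZero p q r)
      (run O (amplify p q r e).2 (run O (reflectMiddle p q r) ψ))) := by
    rw [amplified, amplify]
    simp only [run_append]
    rfl
  have hc : Clean (idle p q r) (run O (amplify p q r e).2 (run O (reflectMiddle p q r) ψ)) :=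
    (clean_run_amplify O e _ (clean_run_reflectCircuit O ancillas_middleQubits hclean)).2
  rw [h1, run_reflectZero O hc, run_sub, run_smul, hinv.right, ← ip_ketZero_left (run O _ _),
    ← hinv.adjoint]
  change middleZero (run O (reflectMiddle p q r) ψ -
    (2 * ip ψ (run O (reflectMiddle p q r) ψ)) • ψ) = _
  rw [run_reflectMiddle O hclean, ip_sub_right, ip_smul_right, ip_amplified_self, ip_middleZero,
    middleZero_sub, middleZero_sub, middleZero_smul, middleZero_smul, middleZero_middleZero]
  funext x
  simp only [Pi.sub_apply, Pi.smul_apply, smul_eq_mul]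
  ring

/-! ### Rotation angle, success probability and output of a round -/

variable {l m n : ℕ} {A : Matrix (Fin l) (Fin m) ℝ} {B : Matrix (Fin m) (Fin n) ℝ}

lemma ip_productState_self (hl : l ≤ 2 ^ p) (hn : n ≤ 2 ^ r) (s : ℕ) (b : Bool)
    {M : Matrix (Fin l) (Fin n) ℝ} (hM : M ≠ 0) :
    ip (productState p q r s b M) (productState p q r s b M) = 1 := by
  rw [ip_self, sum_norm_productState_sq hl hn b hM, Complex.ofReal_one]

lemma middleZero_amplified_zero {O : Access p q r} (hO : O.Encodes A B) (hm : m ≤ 2 ^ q)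
    (hAB : A * B ≠ 0) :
    middleZero (amplified O 0) =
      ((‖A * B‖ / (‖A‖ * ‖B‖) : ℝ) : ℂ) • productState p q r _ false (A * B) := by
  funext x
  obtain ⟨u, v, w, t, rfl⟩ := exists_eq_label x
  have hAB' : (‖A * B‖ : ℂ) ≠ 0 := by simpa using hAB
  simp only [middleZero, forall_middleQubits, Pi.smul_apply, productState_label, flagBits_false]
  have hw : (∀ i, label u v w t (Sum.inr (Sum.inr (Sum.inl i))) = false) ↔ w = zeros _ :=
    ⟨fun h => funext h, fun h => congrFun h⟩
  by_cases h : w = zeros _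
  · rw [if_pos (hw.2 h)]
    subst h
    rw [amplified, amplify, run_prep_label hO hm]
    by_cases ht : t = zeros _
    · simp only [ht, if_true, and_self, smul_eq_mul, Complex.ofReal_div, Complex.ofReal_mul]
      field_simp
    · simp [ht]
  · rw [if_neg (mt hw.1 h), if_neg (fun h' => h h'.1), smul_zero]

/-- The recursion `c ↦ -(3 - 4c²)c` is `sin 3x = 3 sin x - 4 sin³ x` up to sign. The sign becomes a
global phase, so only `|c|` is tracked. -/
lemma exists_middleZero_amplified {O : Access p q r} (hO : O.Encodes A B) (hl : l ≤ 2 ^ p)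
    (hm : m ≤ 2 ^ q) (hn : n ≤ 2 ^ r) (hAB : A * B ≠ 0) {θ : ℝ}
    (hθ : Real.sin θ = ‖A * B‖ / (‖A‖ * ‖B‖)) (e : ℕ) :
    ∃ c : ℝ, |c| = |Real.sin (3 ^ e * θ)| ∧
      middleZero (amplified O e) = (c : ℂ) • productState p q r _ false (A * B) := by
  induction e with
  | zero => exact ⟨Real.sin θ, by simp, by rw [hθ, middleZero_amplified_zero hO hm hAB]⟩
  | succ e ih =>
    obtain ⟨c, hc, h⟩ := ih
    refine ⟨-(3 - 4 * c ^ 2) * c, ?_, ?_⟩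
    · rw [pow_succ' (3 : ℝ), mul_assoc (3 : ℝ), Real.sin_three_mul]
      set σ := Real.sin (3 ^ e * θ)
      rcases abs_eq_abs.1 hc with rfl | rfl
      · rw [← abs_neg]
        congr 1
        ring
      · congr 1
        ring
    · rw [middleZero_amplified_succ, h, ip_smul_right]
      have : ip ((c : ℂ) • productState p q r (ancillaCount p q r) false (A * B))
          (productState p q r (ancillaCount p q r) false (A * B)) = c := by
        have h1 := ip_productState_self (q := q) hl hn (ancillaCount p q r) false hAB
        simp only [ip, Pi.smul_apply, smul_eq_mul, star_mul', RCLike.star_def,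
          Complex.conj_ofReal, mul_assoc, ← Finset.mul_sum] at h1 ⊢
        rw [h1, mul_one]
      rw [this, smul_smul]
      congr 1
      push_cast
      ring

/-- One round: amplify, then raise the flag when the middle register is zero. -/
def amplifyRound (p q r e : ℕ) : Round p q r where
  ancillas := ancillaCount p q r
  circuit := (amplify p q r e).1 ++ flagCircuit anc (middleQubits p q r) flag

lemma successPart_amplifyRound (O : Access p q r) {e : ℕ} {c : ℂ} {M : Matrix (Fin l) (Fin n) ℝ}
    (h : middleZero (amplified O e) = c • productState p q r _ false M) :
    (amplifyRound p q r e).successPart O = c • targetState p q r (amplifyRound p q r e).ancillas M := by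
  have hfin : (amplifyRound p q r e).finalState O =
      run O (flagCircuit anc (middleQubits p q r) flag) (amplified O e) :=
    run_append O (amplify p q r e).1 _ _
  refine funext fun (x : Bits (Wires p q r (ancillaCount p q r))) => ?_
  refine (if_congr Iff.rfl (congrFun hfin x) rfl).trans ?_
  change (if x (flag : Wires p q r (ancillaCount p q r)) = true then
    run O (flagCircuit anc (middleQubits p q r) flag) (amplified O e) x else 0) =
      c * targetState p q r (ancillaCount p q r) M x
  rw [targetState]
  by_cases hx : x flag = true
  · rw [if_pos hx, run_flagCircuit_of_clean O ancillas_middleQubits flag_ne_anc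
      flag_notMem_middleQubits (clean_amplified O e) hx]
    simp only [forall_anc, forall_middleQubits]
    by_cases hc : (∀ t, x (Sum.inr (Sum.inr (Sum.inr (Sum.inr t)))) = false) ∧
      ∀ t, x (Sum.inr (Sum.inr (Sum.inl t))) = false
    · rw [if_pos hc, if_pos ⟨hc.2, hx, hc.1⟩]
      have h1 := congrFun h (Function.update x flag false)
      rw [middleZero, if_pos, Pi.smul_apply, productState, if_pos] at h1
      · exact h1
      · exact ⟨hc.2, Function.update_self _ _ _, hc.1⟩
      · rw [forall_middleQubits]
        exact hc.2
    · rw [if_neg hc, if_neg fun h' => hc ⟨h'.2.2, h'.1⟩, mul_zero]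
  · rw [if_neg hx, if_neg fun h' => hx h'.2.1, mul_zero]

lemma stateNorm_targetState (hl : l ≤ 2 ^ p) (hn : n ≤ 2 ^ r) (s : ℕ)
    {M : Matrix (Fin l) (Fin n) ℝ} (hM : M ≠ 0) :
    stateNorm (targetState p q r s M) = 1 := by
  have h : stateNorm (targetState p q r s M) ^ 2 = 1 := by
    rw [stateNorm_sq, targetState_eq, sum_norm_productState_sq hl hn true hM]
  exact (pow_eq_one_iff_of_nonneg (norm_nonneg _) two_ne_zero).1 h

lemma successProb_amplifyRound {O : Access p q r} (hO : O.Encodes A B) (hl : l ≤ 2 ^ p)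
    (hm : m ≤ 2 ^ q) (hn : n ≤ 2 ^ r) (hAB : A * B ≠ 0) {θ : ℝ}
    (hθ : Real.sin θ = ‖A * B‖ / (‖A‖ * ‖B‖)) (e : ℕ) :
    (amplifyRound p q r e).successProb O = Real.sin (3 ^ e * θ) ^ 2 := by
  obtain ⟨c, hc, h⟩ := exists_middleZero_amplified hO hl hm hn hAB hθ e
  rw [Round.successProb, successPart_amplifyRound O h]
  rw [stateNorm_smul, stateNorm_targetState hl hn _ hAB, mul_one, Complex.norm_real, Real.norm_eq_abs, hc, sq_abs]

lemma isClose_amplifyRound {O : Access p q r} (hO : O.Encodes A B) (hl : l ≤ 2 ^ p)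
    (hm : m ≤ 2 ^ q) (hn : n ≤ 2 ^ r) (hAB : A * B ≠ 0) {ε : ℝ} (hε : 0 ≤ ε)
    {θ : ℝ} (hθ : Real.sin θ = ‖A * B‖ / (‖A‖ * ‖B‖)) (e : ℕ)
    (hs : (amplifyRound p q r e).successProb O ≠ 0) :
    IsClose ε ((amplifyRound p q r e).outputState O) (targetState p q r _ (A * B)) := by
  obtain ⟨c, hc, h⟩ := exists_middleZero_amplified hO hl hm hn hAB hθ e
  have hc0 : c ≠ 0 := by
    rintro rfl
    rw [successProb_amplifyRound hO hl hm hn hAB hθ, ← sq_abs, ← hc] at hs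
    simp at hs
  have hpart := successPart_amplifyRound O h
  have hnorm : stateNorm ((amplifyRound p q r e).successPart O) = |c| := by
    rw [hpart, stateNorm_smul, stateNorm_targetState hl hn _ hAB, mul_one, Complex.norm_real, Real.norm_eq_abs]
  -- The phase is the sign of `c`, and the remaining distance is exactly `0`.
  refine ⟨((|c| : ℝ) : ℂ)⁻¹ * c, ?_, ?_⟩
  · simp [hc0]
  · rw [Round.outputState, hnorm, hpart, smul_smul, sub_self]
    simpa [stateNorm] using hε

end Amplification

/-! ### Time of the rounds -/

/-- With `N = p + q + r + 1`, a step turns a cost `t` into at most `3t + 24N`. Subtracting `12N`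
makes the induction close, and this slack later pays for the flag circuit and the measurement. -/
lemma gateTime_amplify_le {p q r : ℕ} {τ : ℝ} (e : ℕ) :
    gateTime τ (amplify p q r e).1 ≤
        3 ^ e * (3 * τ + 12 * (p + q + r + 1)) - 12 * (p + q + r + 1) ∧
      gateTime τ (amplify p q r e).2 ≤
        3 ^ e * (3 * τ + 12 * (p + q + r + 1)) - 12 * (p + q + r + 1) := by
  induction e with
  | zero =>
    constructor <;> simp only [amplify, prep, prepInv, gateTime_cons, gateTime_nil, Gate.time] <;>
      linarith
  | succ e ih =>
    obtain ⟨h1, h2⟩ := ih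
    have h3 := gateTime_reflectCircuit_le (p := p) (q := q) (r := r) τ anc (middleQubits p q r)
    have h4 := gateTime_reflectCircuit_le (p := p) (q := q) (r := r) τ anc (registerQubits p q r)
    rw [length_middleQubits] at h3
    rw [length_registerQubits] at h4
    push_cast at h3 h4
    have hp : (0 : ℝ) ≤ p := Nat.cast_nonneg _
    have hr : (0 : ℝ) ≤ r := Nat.cast_nonneg _
    simp only [amplify, reflectMiddle, reflectZero, gateTime_append, pow_succ]
    constructor <;> linarith

lemma time_amplifyRound_le {p q r : ℕ} {τ : ℝ} (e : ℕ) :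
    (amplifyRound p q r e).time τ ≤ 3 ^ e * (3 * τ + 12 * (p + q + r + 1)) := by
  have h1 := (gateTime_amplify_le (p := p) (q := q) (r := r) (τ := τ) e).1
  have h2 := gateTime_flagCircuit_le (p := p) (q := q) (r := r) τ anc (middleQubits p q r) flag
  rw [length_middleQubits] at h2
  have h3 : (amplifyRound p q r e).time τ = gateTime τ (amplify p q r e).1 +
      gateTime (p := p) (q := q) (r := r) τ
        (flagCircuit anc (middleQubits p q r) flag) + 1 := by
    rw [← gateTime_append]
    rfl
  have hp : (0 : ℝ) ≤ p := Nat.cast_nonneg _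
  have hr : (0 : ℝ) ≤ r := Nat.cast_nonneg _
  have hq : (0 : ℝ) ≤ q := Nat.cast_nonneg _
  linarith

/-! ### Real estimates -/

/-- Some power of `3` amplifies the amplitude `s` to at least `1 / 2` without overshooting. -/
lemma exists_pow_sin_sq_ge {s : ℝ} (hs : 0 < s) (hs1 : s ≤ 1) :
    ∃ E : ℕ, 3 ^ E * s ≤ 2 ∧ 1 / 4 ≤ Real.sin (3 ^ E * Real.arcsin s) ^ 2 := by
  set θ := Real.arcsin s with hθ
  have hsin : Real.sin θ = s := Real.sin_arcsin (by linarith) hs1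
  have hθ0 : 0 < θ := Real.arcsin_pos.2 hs
  have hθ1 : θ ≤ Real.pi / 2 := Real.arcsin_le_pi_div_two s
  have hsθ : s ≤ θ := hsin ▸ Real.sin_le hθ0.le
  have hπ := Real.pi_pos
  have hπ4 := Real.pi_le_four
  have hex : ∃ E : ℕ, Real.pi / 6 ≤ 3 ^ E * θ := by
    obtain ⟨E, hE⟩ := pow_unbounded_of_one_lt (Real.pi / 6 / θ) (by norm_num : (1 : ℝ) < 3)
    exact ⟨E, (div_le_iff₀ hθ0).1 hE.le⟩
  classical
  set E := Nat.find hex with hE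
  have h1 : Real.pi / 6 ≤ 3 ^ E * θ := Nat.find_spec hex
  -- By minimality the previous angle is below `π/6`, so its triple stays below `π/2`; at `E = 0`
  -- the range of `arcsin` suffices.
  have h2 : 3 ^ E * θ ≤ Real.pi / 2 := by
    rcases Nat.eq_zero_or_pos E with h0 | hpos
    · rw [h0]
      simpa using hθ1
    · have h3 : ¬ Real.pi / 6 ≤ 3 ^ (E - 1) * θ := Nat.find_min hex (by omega)
      have h4 : (3 : ℝ) ^ E = 3 * 3 ^ (E - 1) := by
        rw [← pow_succ']
        congr 1
        omega
      rw [h4]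
      linarith
  refine ⟨E, ?_, ?_⟩
  · have : 3 ^ E * s ≤ 3 ^ E * θ := by gcongr
    linarith
  · have h3 : 1 / 2 ≤ Real.sin (3 ^ E * θ) := by
      rw [← Real.sin_pi_div_six]
      exact Real.sin_le_sin_of_le_of_le_pi_div_two (by linarith) h2 h1
    nlinarith

/-- The number of repetitions of each round that reduces the probability of failure to `δ`. -/
def repetitions (δ : ℝ) : ℕ := ⌈4 * Real.log (1 / δ)⌉₊ + 1

lemma repetitions_le {δ : ℝ} (h0 : 0 < δ) (h1 : δ < 1) :
    (repetitions δ : ℝ) ≤ 4 * (1 + Real.log (1 / δ)) := by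
  have hlog : 0 ≤ Real.log (1 / δ) := Real.log_nonneg (by rw [le_div_iff₀ h0]; linarith)
  have := Nat.ceil_lt_add_one (by positivity : 0 ≤ 4 * Real.log (1 / δ))
  rw [repetitions]
  push_cast
  linarith

/-- A try at the good level fails with probability at most `3/4 ≤ exp(-1/4)`, hence the factor `4`
in the number of repetitions. -/
lemma pow_repetitions_le {δ : ℝ} (h0 : 0 < δ) : (3 / 4 : ℝ) ^ repetitions δ ≤ δ := by
  have h1 : (3 / 4 : ℝ) ≤ Real.exp (-1 / 4) := by
    have := Real.add_one_le_exp (-1 / 4 : ℝ)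
    linarith
  calc (3 / 4 : ℝ) ^ repetitions δ ≤ Real.exp (-1 / 4) ^ repetitions δ := by gcongr
    _ = Real.exp (repetitions δ * (-1 / 4)) := (Real.exp_nat_mul _ _).symm
    _ ≤ Real.exp (Real.log δ) := by
      apply Real.exp_le_exp.2
      have h2 := Nat.le_ceil (4 * Real.log (1 / δ))
      rw [repetitions]
      rw [one_div, Real.log_inv] at h2 ⊢
      push_cast
      linarith
    _ = δ := Real.exp_log h0

lemma sum_range_mul_div (f : ℕ → ℝ) {R : ℕ} (hR : 0 < R) (E : ℕ) :
    ∑ j ∈ Finset.range (E * R), f (j / R) = R * ∑ e ∈ Finset.range E, f e := by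
  induction E with
  | zero => simp
  | succ E ih =>
    rw [Nat.succ_mul, Finset.sum_range_add, ih, Finset.sum_range_succ, mul_add]
    congr 1
    rw [Finset.sum_congr rfl (g := fun _ => f E), Finset.sum_const, Finset.card_range,
      nsmul_eq_mul]
    intro j hj
    rw [mul_comm, Nat.mul_add_div hR, Nat.div_eq_of_lt (Finset.mem_range.1 hj), add_zero]

lemma sum_range_three_pow_le (E : ℕ) : ∑ e ∈ Finset.range E, (3 : ℝ) ^ e ≤ 3 ^ E / 2 := by
  induction E with
  | zero => simp
  | succ E ih =>
    rw [Finset.sum_range_succ, pow_succ]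
    linarith

/-- Only the block of `R` tries at level `E` is used; all earlier factors are at most `1`. -/
lemma prod_range_one_sub_le {f : ℕ → ℝ} (h0 : ∀ e, 0 ≤ f e) (h1 : ∀ e, f e ≤ 1) {R E : ℕ}
    (hR : 0 < R) {c : ℝ} (hc : c ≤ f E) :
    ∏ j ∈ Finset.range ((E + 1) * R), (1 - f (j / R)) ≤ (1 - c) ^ R := by
  rw [Nat.succ_mul, Finset.prod_range_add]
  have h2 : ∏ j ∈ Finset.range (E * R), (1 - f (j / R)) ≤ 1 :=
    Finset.prod_le_one (fun j _ => by linarith [h1 (j / R)]) fun j _ => by linarith [h0 (j / R)]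
  have h3 : ∏ j ∈ Finset.range R, (1 - f ((E * R + j) / R)) = (1 - f E) ^ R := by
    rw [Finset.prod_congr rfl (g := fun _ => 1 - f E), Finset.prod_const, Finset.card_range]
    intro j hj
    rw [mul_comm, Nat.mul_add_div hR, Nat.div_eq_of_lt (Finset.mem_range.1 hj), add_zero]
  rw [h3]
  have h4 : 0 ≤ 1 - f E := by linarith [h1 E]
  calc _ ≤ 1 * (1 - f E) ^ R := by gcongr
    _ ≤ (1 - c) ^ R := by
      rw [one_mul]
      gcongr

/-- For `l > 1` this follows from `2 ^ (clog l - 1) < l` and `log 2 > 1/2`. -/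
lemma clog_two_le {l : ℕ} (hl : 0 < l) : (Nat.clog 2 l : ℝ) ≤ 1 + 2 * Real.log l := by
  rcases Nat.lt_or_ge 1 l with h | h
  · have h1 : 2 ^ (Nat.clog 2 l).pred < l := Nat.pow_pred_clog_lt_self one_lt_two h
    have h2 : 0 < Nat.clog 2 l := Nat.clog_pos one_lt_two h
    have h3 : ((Nat.clog 2 l - 1 : ℕ) : ℝ) * Real.log 2 ≤ Real.log l := by
      rw [← Real.log_pow]
      apply Real.log_le_log (by positivity)
      exact_mod_cast h1.le
    rw [Nat.cast_sub h2, Nat.cast_one] at h3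
    have h4 := Real.log_two_gt_d9
    have h5 : (1 : ℝ) ≤ Nat.clog 2 l := by exact_mod_cast h2
    nlinarith
  · have : l = 1 := by omega
    simp [this]

/-- A nonzero matrix has positive rank, so the denominator is a genuine positive singular value, and
the list is decreasing. -/
lemma one_le_condNumber {m n : ℕ} {M : Matrix (Fin m) (Fin n) ℝ} (hM : M ≠ 0) :
    1 ≤ condNumber M := by
  set T := Matrix.toEuclideanLin M with hT
  have hrank : M.rank = Module.finrank ℝ T.range :=
    M.rank_eq_finrank_range_toLin (EuclideanSpace.basisFun _ ℝ).toBasis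
      (EuclideanSpace.basisFun _ ℝ).toBasis
  have hT0 : T ≠ 0 := by simpa [hT] using hM
  have hpos : 0 < M.rank := by
    rw [hrank, Nat.pos_iff_ne_zero]
    intro h
    exact hT0 (LinearMap.range_eq_bot.1 (Submodule.finrank_eq_zero.1 h))
  have h1 : 0 < T.singularValues (M.rank - 1) :=
    T.singularValues_pos_iff_lt_finrank_range.2 (by omega)
  rw [condNumber, le_div_iff₀ h1, one_mul]
  exact T.singularValues_antitone (Nat.zero_le _)

end QMatMul

end

/-! ### The search over levels and its total time -/

open QMatMul

theorem mainTheorem9 :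
    ∃ alg : (l m n : ℕ) → (ε δ : ℝ) → QMatMul.Algorithm l m n,
      ∀ a : ℕ, ∃ (C : ℝ) (k : ℕ), ∀ (l m n : ℕ)
        (A : Matrix (Fin l) (Fin m) ℝ) (B : Matrix (Fin m) (Fin n) ℝ), A * B ≠ 0 →
        ∀ ε δ : ℝ, 0 < ε → ε ≤ 1 → 0 < δ → δ < 1 →
        ∀ O : QMatMul.Access (Nat.clog 2 l) (Nat.clog 2 m) (Nat.clog 2 n), O.Encodes A B →
          (∀ j : ℕ, (alg l m n ε δ j).successProb O ≠ 0 →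
            QMatMul.IsClose ε ((alg l m n ε δ j).outputState O)
              (QMatMul.targetState _ _ _ _ (A * B))) ∧
          ∃ K : ℕ,
            1 - δ ≤ (alg l m n ε δ).successProb O K ∧
            (alg l m n ε δ).time ((1 + Real.log (l * m * n)) ^ a) K ≤
              C * (‖A‖ * ‖B‖ * QMatMul.condNumber A ^ 2 / (ε * ‖A * B‖)) *
                (1 + Real.log (l * m * n)) ^ k * (1 + Real.log (1 / δ)) := by
  -- Round `j` works at level `j / repetitions δ`. The constant is `612 = 2 · 306` with `306 = 4 ·
  -- (3/2) · 51`: repetitions, geometric sum, and cost per unit of `3 ^ e`.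
  refine ⟨fun l m n _ δ j => amplifyRound _ _ _ (j / repetitions δ), fun a => ⟨612, a + 1, ?_⟩⟩
  intro l m n A B hAB ε δ hε hε1 hδ hδ1 O hO
  have hA : A ≠ 0 := by rintro rfl; simp at hAB
  have hB : B ≠ 0 := by rintro rfl; simp at hAB
  have hA0 : 0 < ‖A‖ := norm_pos_iff.2 hA
  have hB0 : 0 < ‖B‖ := norm_pos_iff.2 hB
  have hAB0 : 0 < ‖A * B‖ := norm_pos_iff.2 hAB
  have hl : 0 < l := by
    rcases Nat.eq_zero_or_pos l with rfl | h
    · exact absurd (Subsingleton.elim _ _) hA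
    · exact h
  have hm : 0 < m := by
    rcases Nat.eq_zero_or_pos m with rfl | h
    · exact absurd (Subsingleton.elim _ _) hA
    · exact h
  have hn : 0 < n := by
    rcases Nat.eq_zero_or_pos n with rfl | h
    · exact absurd (Subsingleton.elim _ _) hB
    · exact h
  have hl2 : l ≤ 2 ^ Nat.clog 2 l := Nat.le_pow_clog one_lt_two l
  have hm2 : m ≤ 2 ^ Nat.clog 2 m := Nat.le_pow_clog one_lt_two m
  have hn2 : n ≤ 2 ^ Nat.clog 2 n := Nat.le_pow_clog one_lt_two n
  set s := ‖A * B‖ / (‖A‖ * ‖B‖) with hs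
  have hs0 : 0 < s := by positivity
  have hs1 : s ≤ 1 := (div_le_one (by positivity)).2 (Matrix.frobenius_norm_mul A B)
  have hθ : Real.sin (Real.arcsin s) = s := Real.sin_arcsin (by linarith) hs1
  have hprob := successProb_amplifyRound hO hl2 hm2 hn2 hAB hθ
  refine ⟨fun j hj => isClose_amplifyRound hO hl2 hm2 hn2 hAB hε.le hθ _ hj, ?_⟩
  obtain ⟨E, hE, hsinE⟩ := exists_pow_sin_sq_ge hs0 hs1
  set R := repetitions δ with hR
  have hR0 : 0 < R := Nat.succ_pos _
  refine ⟨(E + 1) * R, ?_, ?_⟩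
  · simp only [Algorithm.successProb, hprob]
    have h1 := prod_range_one_sub_le (f := fun e => Real.sin (3 ^ e * Real.arcsin s) ^ 2)
      (fun e => sq_nonneg _) (fun e => Real.sin_sq_le_one _) hR0 hsinE
    have h2 := pow_repetitions_le hδ
    norm_num at h1
    linarith
  · set Λ := 1 + Real.log (l * m * n) with hΛ
    have hl1 : (1 : ℝ) ≤ l := by exact_mod_cast hl
    have hm1 : (1 : ℝ) ≤ m := by exact_mod_cast hm
    have hn1 : (1 : ℝ) ≤ n := by exact_mod_cast hn
    have hlog : Real.log (l * m * n) = Real.log l + Real.log m + Real.log n := by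
      rw [Real.log_mul (by positivity) (by positivity), Real.log_mul (by positivity)
        (by positivity)]
    have hΛ1 : 1 ≤ Λ := by
      have := Real.log_nonneg hl1
      have := Real.log_nonneg hm1
      have := Real.log_nonneg hn1
      linarith
    have hpow : 1 ≤ Λ ^ a := one_le_pow₀ hΛ1
    -- The three register sizes add up to at most `3 + 2(Λ - 1)`, so the second term is at most `24
    -- + 24Λ ≤ 48Λ`.
    have hQ : 3 * Λ ^ a + 12 * ((Nat.clog 2 l : ℝ) + Nat.clog 2 m + Nat.clog 2 n + 1) ≤
        51 * Λ ^ (a + 1) := by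
      have h1 := clog_two_le hl
      have h2 := clog_two_le hm
      have h3 := clog_two_le hn
      have h4 : Λ ≤ Λ ^ (a + 1) := le_self_pow₀ hΛ1 (by omega)
      have h5 : Λ ^ a ≤ Λ ^ (a + 1) := pow_le_pow_right₀ hΛ1 (by omega)
      linarith
    have hL : 0 ≤ 1 + Real.log (1 / δ) := by
      have : 0 ≤ Real.log (1 / δ) := Real.log_nonneg (by rw [le_div_iff₀ hδ]; linarith)
      linarith
    -- The factor `κ² / ε` is at least `1`, so inserting it only weakens the bound.
    have hκ : ‖A‖ * ‖B‖ / ‖A * B‖ ≤ ‖A‖ * ‖B‖ * condNumber A ^ 2 / (ε * ‖A * B‖) := by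
      have h1 : 1 ≤ condNumber A ^ 2 := one_le_pow₀ (one_le_condNumber hA)
      apply div_le_div₀ (by positivity) _ (by positivity) (mul_le_of_le_one_left hAB0.le hε1)
      exact le_mul_of_one_le_right (by positivity) h1
    have hE' : (3 : ℝ) ^ E ≤ 2 * (‖A‖ * ‖B‖ / ‖A * B‖) := by
      rw [← inv_div, ← hs, ← div_eq_mul_inv, le_div_iff₀ hs0]
      exact hE
    calc Algorithm.time _ (Λ ^ a) ((E + 1) * R)
        ≤ ∑ j ∈ Finset.range ((E + 1) * R), (3 : ℝ) ^ (j / R) * (51 * Λ ^ (a + 1)) :=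
          Finset.sum_le_sum fun j _ => (time_amplifyRound_le _).trans (by gcongr)
      _ = R * (∑ e ∈ Finset.range (E + 1), (3 : ℝ) ^ e) * (51 * Λ ^ (a + 1)) := by
        rw [← Finset.sum_mul, sum_range_mul_div (fun e => (3 : ℝ) ^ e) hR0]
      _ ≤ (4 * (1 + Real.log (1 / δ))) * (3 ^ (E + 1) / 2) * (51 * Λ ^ (a + 1)) := by
        gcongr
        · exact repetitions_le hδ hδ1
        · exact sum_range_three_pow_le _
      _ = 306 * 3 ^ E * Λ ^ (a + 1) * (1 + Real.log (1 / δ)) := by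
        rw [pow_succ (3 : ℝ)]
        ring
      _ ≤ 306 * (2 * (‖A‖ * ‖B‖ * condNumber A ^ 2 / (ε * ‖A * B‖))) * Λ ^ (a + 1) *
          (1 + Real.log (1 / δ)) := by
        gcongr
        exact hE'.trans (by gcongr)
      _ = _ := by ring
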